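/- Throughout, $\mathbb N=\{0,1,2,\dots\}$, $1\le p<\infty$, $\ell_p(\mathbb N)$ is the space of complex $p$-summable sequences and $(e_k)_{k\ge0}$ its canonical basis. \textbf{Operators of C-type.} Let $v=(v_n)_{n\ge1}$ be non-zero complex numbers with $\sum_{n\ge 1}|v_n|<\infty$; $w=(w_j)_{j\ge1}$ complex numbers with $0<\inf_j|w_j|\le\sup_j|w_j|<\infty$; $\varphi:\mathbb N\to\mathbb N$ with $\varphi(0)=0$, $\varphi(n)<n$ for $n\ge1$, and $\varphi^{-1}(l)$ infinite for every $l\ge0$; $b=(b_n)_{n\ge0}$ a strictly increasing sequence of integers with $b_0=0$ such that $b_{n+1}-b_n$ is a multiple of $2(b_{\varphi(n)+1}-b_{\varphi(n)})$ for every $n\ge1$; and assume $\inf_{n\ge0}\prod_{b_n<j<b_{n+1}}|w_j|>0$. The operator of C-type $T=T_{v,w,\varphi,b}$ on $\ell_p(\mathbb N)$ is the bounded operator with \[ Te_k=\begin{cases} w_{k+1}e_{k+1}, & b_n\le k<b_{n+1}-1,\ n\ge0,\\ v_n e_{b_{\varphi(n)}}-\Bigl(\prod_{j=b_n+1}^{b_{n+1}-1}w_j\Bigr)^{-1}e_{b_n},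 & k=b_{n+1}-1,\ n\ge1,\\ -\Bigl(\prod_{j=1}^{b_1-1}w_j\Bigr)^{-1}e_0, & k=b_1-1.\end{cases} \] \textbf{Operators of C$_2$-type.} Let $(a_k),(f_k),(\delta^{(k)}),(\tau^{(k)}),(\Delta^{(k)})$, $k\ge1$, be non-decreasing sequences of integers with $0\le a_k\le f_k<\Delta^{(k)}-4\delta^{(k)}$ and $\delta^{(k)}\ge0$ for all $k\ge1$. Let $J_0=\{0\},J_1,J_2,\dots$ be consecutive finite intervals of $\mathbb N$ with $\#J_k=(f_k-a_k)\sum_{i=0}^{k-1}\#J_i$ for $k\ge1$, and assume that they form a partition of $\mathbb N$. The operator of C-type $T_{v,w,\varphi,b}$ is of C$_2$-type, with these parameters, if for all $k\ge1$ and $n\in J_k$: $\varphi(n)=\bigl\lfloor\frac{n-\min J_k}{f_k-a_k}\bigr\rfloor$; $b_{n+1}-b_n=\Delta^{(k)}$; $v_n=2^{-\tau^{(k)}}$; and, with $l=(n-\min J_k)\bmod (f_k-a_k)$ and $b_n<j<b_{n+1}$, \[ w_j=\begin{cases} 2 & b_n<j\le b_n+\delta^{(k)},\\ 1 & b_n+\delta^{(k)}<j<b_{n+1}-a_k-l-2\delta^{(k)},\\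 1/2 & b_{n+1}-a_k-l-2\delta^{(k)}\le j<b_{n+1}-a_k-l-\delta^{(k)},\\ 2 & b_{n+1}-a_k-l-\delta^{(k)}\le j<b_{n+1}-a_k-l,\\ 1 & b_{n+1}-a_k-l\le j<b_{n+1}.\end{cases} \] The block $[0,b_1)$ is subject only to the requirements for C-type. Fix moreover an arbitrary integer $\delta^{(0)}\ge0$ (used only in $\gamma_1$) and put $\gamma_k=2^{\delta^{(k-1)}-\tau^{(k)}}\bigl(\Delta^{(k)}\bigr)^{1-\frac1p}$ for $k\ge1$. \textbf{Conditions.} $(\gamma_k)_{k\ge1}$ is non-increasing; \[2\sum_{k\ge1}\#J_k\,\gamma_k^{1/2}\le1,\qquad \lim_{k\to\infty}\frac{\delta^{(k)}}{a_k}=0\ \ (\text{with } a_k>0 \text{ for all large } k),\qquad \lim_{k\to\infty}(\delta^{(k)}-\tau^{(k)})=\infty;\] and $\bigcup_{k\ge1}[a_k+\delta^{(k)},f_k+\delta^{(k)})$ is cofinite in $\mathbb N$. \textbf{Dynamics.} $T$ is \emph{chaotic} if it has a vector with dense orbit and a dense set of periodic points; \emph{topologically mixing} if for all non-empty open $U,V$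 one has $T^i(U)\cap V\ne\emptyset$ for all but finitely many $i$; \emph{$\mathcal U$-frequently hypercyclic} if there is a vector $x$ such that $\{i\in\mathbb N: T^ix\in V\}$ has positive upper density for every non-empty open $V$. \textbf{Theorem.} (1) For all C$_2$-type data satisfying the Conditions, the operator of C$_2$-type $T$ on $\ell_p(\mathbb N)$ exists and is unique, and it is chaotic and topologically mixing but not $\mathcal U$-frequently hypercyclic. (2) For every integer $\delta^{(0)}\ge 0$ there is $C_0$ such that for every integer $C\ge C_0$ the parameters \[\Delta^{(k)}=2^{2Ck^2+5},\quad \delta^{(k)}=2^{Ck^2+1},\quad \tau^{(k)}=2^{Ck^2},\quad a_k=k\,\delta^{(k)},\quad f_k=\tfrac12\Delta^{(k)}\qquad(k\ge1)\] satisfy the Conditions, there exist C$_2$-type data with these parameters, and every operator of C$_2$-type $T$ on $\ell_p(\mathbb N)$ with these parameters exists, is unique for its data, and is chaotic and topologically mixing but not $\mathcal U$-frequently hypercyclic. -/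

import Mathlib

open Filter Topology
open scoped ENNReal

namespace CType

/-! ### Linear dynamics -/

section Dynamics

variable {X : Type*} [TopologicalSpace X]

/-- Some orbit of `T` is dense. -/
def IsHypercyclic (T : X → X) : Prop :=
  ∃ x, Dense (Set.range fun i : ℕ => T^[i] x)

/-- Devaney chaos for (linear) maps: hypercyclic with a dense set of periodic points. -/
def IsChaotic (T : X → X) : Prop :=
  IsHypercyclic T ∧ Dense (Function.periodicPts T)

/-- For all non-empty open `U`, `V`, the set of `i` with `T^i U ∩ V ≠ ∅` is cofinite. -/
def IsTopologicallyMixing (T : X → X) : Prop :=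
  ∀ U V : Set X, IsOpen U → U.Nonempty → IsOpen V → V.Nonempty →
    {i : ℕ | (T^[i] '' U ∩ V).Nonempty}ᶜ.Finite

/-- Upper (asymptotic) density of a set of natural numbers. -/
noncomputable def upperDensity (A : Set ℕ) : ℝ :=
  limsup (fun n : ℕ => ((A ∩ Set.Iio n).ncard : ℝ) / n) atTop

/-- Some orbit visits every non-empty open set along a set of times of positive upper density. -/
def IsUFrequentlyHypercyclic (T : X → X) : Prop :=
  ∃ x, ∀ V : Set X, IsOpen V → V.Nonempty → 0 < upperDensity {i : ℕ | T^[i] x ∈ V}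

end Dynamics

/-! ### Operators of C-type -/

/-- The space `ℓ_p(ℕ)` of complex sequences, `ℕ = {0, 1, 2, …}`. -/
abbrev Ell (p : ℝ≥0∞) : Type := lp (fun _ : ℕ => ℂ) p

/-- The canonical basis vector `e_k` of `ℓ_p(ℕ)`. -/
noncomputable def e (p : ℝ≥0∞) (k : ℕ) : Ell p := lp.single p k (1 : ℂ)

/-- The data `(v, w, φ, b)` of an operator of C-type. The entries `v 0` and `w 0` are not used. -/
structure Data where
  v : ℕ → ℂ
  w : ℕ → ℂ
  φ : ℕ → ℕ
  b : ℕ → ℕ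
  v_ne_zero : ∀ n, 1 ≤ n → v n ≠ 0
  v_summable : Summable fun n : ℕ => ‖v (n + 1)‖
  w_bounded : ∃ M : ℝ, ∀ j, 1 ≤ j → ‖w j‖ ≤ M
  w_bounded_below : ∃ c : ℝ, 0 < c ∧ ∀ j, 1 ≤ j → c ≤ ‖w j‖
  φ_zero : φ 0 = 0
  φ_lt : ∀ n, 1 ≤ n → φ n < n
  φ_infinite : ∀ l, {n : ℕ | φ n = l}.Infinite
  b_zero : b 0 = 0
  b_strictMono : StrictMono b
  b_dvd : ∀ n, 1 ≤ n → 2 * (b (φ n + 1) - b (φ n)) ∣ b (n + 1) - b n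
  /-- The products of the weights over the blocks are bounded below. -/
  prod_bounded_below : ∃ c : ℝ, 0 < c ∧ ∀ n, c ≤ ∏ j ∈ Finset.Ioo (b n) (b (n + 1)), ‖w j‖

/-- The product of the weights `w_j` over `b_n < j < b_{n+1}`. -/
noncomputable def Data.blockProd (d : Data) (n : ℕ) : ℂ :=
  ∏ j ∈ Finset.Ioo (d.b n) (d.b (n + 1)), d.w j

/-- `T` is the operator of C-type `T_{v,w,φ,b}` on `ℓ_p(ℕ)`: the bounded operator which takes
the prescribed values on the canonical basis. -/
structure Data.IsOperator (d : Data) (p : ℝ≥0∞) [Fact (1 ≤ p)] (T : Ell p →L[ℂ] Ell p) :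
    Prop where
  map_inner : ∀ n k, d.b n ≤ k → k + 1 < d.b (n + 1) → T (e p k) = d.w (k + 1) • e p (k + 1)
  map_last : ∀ n, 1 ≤ n → T (e p (d.b (n + 1) - 1)) =
    d.v n • e p (d.b (d.φ n)) - (d.blockProd n)⁻¹ • e p (d.b n)
  map_last_zero : T (e p (d.b 1 - 1)) = -((d.blockProd 0)⁻¹ • e p 0)

/-! ### Operators of C₂-type -/

/-- The numerical parameters of an operator of C₂-type. They are meant for indices `k ≥ 1`; the
only value at `0` that is ever used is `δ 0`, which occurs in `γ 1`. -/
structure Params where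
  a : ℕ → ℕ
  f : ℕ → ℕ
  δ : ℕ → ℕ
  τ : ℕ → ℤ
  Δ : ℕ → ℕ

namespace Params

variable (P : Params)

/-- `#J_0 = 1` and `#J_k = (f_k - a_k) ∑_{i<k} #J_i`. -/
def cardJ : ℕ → ℕ
  | 0 => 1
  | k + 1 => (P.f (k + 1) - P.a (k + 1)) * ∑ i : Fin (k + 1), cardJ i.1
termination_by k => k
decreasing_by exact i.2

/-- The left end point `∑_{i<k} #J_i` of `J_k`. -/
def minJ (k : ℕ) : ℕ := ∑ i ∈ Finset.range k, P.cardJ i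

/-- The consecutive intervals `J_0, J_1, …`, with `J_0 = {0}`. -/
def J (k : ℕ) : Finset ℕ := Finset.Ico (P.minJ k) (P.minJ (k + 1))

theorem card_J (k : ℕ) : (P.J k).card = P.cardJ k := by
  simp [J, minJ, Finset.sum_range_succ]

theorem J_zero : P.J 0 = {0} := by
  simp [J, minJ, cardJ]

theorem card_J_of_pos (k : ℕ) (hk : 1 ≤ k) :
    (P.J k).card = (P.f k - P.a k) * ∑ i ∈ Finset.range k, (P.J i).card := by
  obtain ⟨k, rfl⟩ := Nat.exists_eq_add_of_le' hk
  simp only [card_J]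
  rw [cardJ, Finset.sum_range]

/-- The weight `w_{b_n + i}`, `1 ≤ i < Δ^{(k)}`, where `n ∈ J_k` and
`l = (n - min J_k) mod (f_k - a_k)`: it is `2` for `i ≤ δ`, then `1` for
`i < Δ - a - l - 2δ`, then `1/2` for `i < Δ - a - l - δ`, then `2` for `i < Δ - a - l`,
and `1` afterwards. -/
noncomputable def weight (k l i : ℕ) : ℂ :=
  if i ≤ P.δ k then 2
  else if i + P.a k + l + 2 * P.δ k < P.Δ k then 1
  else if i + P.a k + l + P.δ k < P.Δ k then 1 / 2
  else if i + P.a k + l < P.Δ k then 2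
  else 1

/-- The C-type data `d` are of C₂-type with parameters `P`. -/
structure IsC2Type (d : Data) : Prop where
  a_mono : MonotoneOn P.a (Set.Ici 1)
  f_mono : MonotoneOn P.f (Set.Ici 1)
  δ_mono : MonotoneOn P.δ (Set.Ici 1)
  τ_mono : MonotoneOn P.τ (Set.Ici 1)
  Δ_mono : MonotoneOn P.Δ (Set.Ici 1)
  a_le_f : ∀ k, 1 ≤ k → P.a k ≤ P.f k
  f_lt : ∀ k, 1 ≤ k → P.f k + 4 * P.δ k < P.Δ k
  /-- The intervals `J_k` form a partition of `ℕ`. -/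
  J_cover : ∀ n, ∃ k, n ∈ P.J k
  φ_eq : ∀ k, 1 ≤ k → ∀ n ∈ P.J k, d.φ n = (n - P.minJ k) / (P.f k - P.a k)
  b_eq : ∀ k, 1 ≤ k → ∀ n ∈ P.J k, d.b (n + 1) - d.b n = P.Δ k
  v_eq : ∀ k, 1 ≤ k → ∀ n ∈ P.J k, d.v n = (2 : ℂ) ^ (-P.τ k)
  w_eq : ∀ k, 1 ≤ k → ∀ n ∈ P.J k, ∀ i, 1 ≤ i → i < P.Δ k →
    d.w (d.b n + i) = P.weight k ((n - P.minJ k) % (P.f k - P.a k)) i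

/-- `γ_k = 2^{δ^{(k-1)} - τ^{(k)}} (Δ^{(k)})^{1 - 1/p}`, for `k ≥ 1`. -/
noncomputable def γ (p : ℝ≥0∞) (k : ℕ) : ℝ :=
  (2 : ℝ) ^ ((P.δ (k - 1) : ℤ) - P.τ k) * (P.Δ k : ℝ) ^ (1 - 1 / p.toReal)

/-- The conditions on the parameters which ensure chaos and mixing without
`𝒰`-frequent hypercyclicity. -/
structure Conditions (p : ℝ≥0∞) : Prop where
  γ_anti : AntitoneOn (P.γ p) (Set.Ici 1)
  γ_summable : Summable fun k : ℕ => ((P.J (k + 1)).card : ℝ) * √(P.γ p (k + 1))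
  γ_sum_le : 2 * ∑' k : ℕ, ((P.J (k + 1)).card : ℝ) * √(P.γ p (k + 1)) ≤ 1
  /-- The quotients `δ^{(k)}/a_k` make sense for all large `k`. -/
  a_pos : ∀ᶠ k in atTop, 0 < P.a k
  δ_div_a : Tendsto (fun k : ℕ => (P.δ k : ℝ) / (P.a k : ℝ)) atTop (𝓝 0)
  δ_sub_τ : Tendsto (fun k : ℕ => (P.δ k : ℤ) - P.τ k) atTop atTop
  cofinite : (⋃ k ∈ Set.Ici 1, Set.Ico (P.a k + P.δ k) (P.f k + P.δ k))ᶜ.Finite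

/-- For `k ≥ 1`: `Δ^{(k)} = 2^{2Ck²+5}`, `δ^{(k)} = 2^{Ck²+1}`, `τ^{(k)} = 2^{Ck²}`,
`a_k = k δ^{(k)}`, `f_k = Δ^{(k)}/2`; the value `δ^{(0)} = δ₀` is arbitrary. -/
def sample (δ₀ C : ℕ) : Params where
  a k := k * 2 ^ (C * k ^ 2 + 1)
  f k := 2 ^ (2 * C * k ^ 2 + 5) / 2
  δ k := if k = 0 then δ₀ else 2 ^ (C * k ^ 2 + 1)
  τ k := 2 ^ (C * k ^ 2)
  Δ k := 2 ^ (2 * C * k ^ 2 + 5)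

end Params

end CType

/-!
The operator is a sum of a weighted cyclic permutation of each block `[b_n, b_{n+1})`, which has
bounded weights, and of an absolutely convergent series of rank one operators; it is unique because
the `e_k` span a dense subspace. Write `L_n` for the length of the block `n` and `W_n` for the
product of its weights. Then `T^{L_n} e_{b_n} = W_n v_n e_{b_{φ(n)}} - e_{b_n}`, and since `L_n` is a
multiple of `2 L_{φ(n)}` all basis vectors are periodic (`Data.IsOperator.pow_two_mul_len`). The
orbit of `e_{b_n}` turns around its block, and during every second turn it is accompanied by a
multiple of the orbit of `e_{b_{φ(n)}}` (`Data.IsOperator.pow_mul_len_add`).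

*Mixing and chaos.* Call `y` reachable if for all large `i` there is a small `z` with `T^i z` close
to `y`. As the periodic points are dense, mixing follows once all vectors are reachable
(`isTopologicallyMixing_of_reachable`), and for this it is enough to reach each `e_{b_l}`. Given a
large `i`, choose `k` with `a_k + δ^{(k)} ≤ i < f_k + δ^{(k)}` and then the block `n` in `J_k` with
`φ(n) = l` in which the last run of weights `2` starts `i` steps before the end. A multiple `z` of
`e_{b_{n+1} - i}` of norm about `2^{τ^{(k)} - δ^{(k)}}` has `T^i z` close to `e_{b_l}`
(`Params.IsC2Type.e_mem_reachable`). Hypercyclicity follows from mixing by the Baire category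
theorem.

*Failure of `𝒰`-frequent hypercyclicity.* Let `x` have a dense orbit, and let `β_n` be the largest
modulus of a partial product of weights in the block `n`; it is attained on most of the block. The
size of `x` in the block `n` at time `N` is the `ℓ_p`-norm of those coordinates in the block which
reach its end within `N` steps, each rescaled to the modulus which it has where the partial product
is `β_n`. Within `N` steps the block `n` perturbs a block `l` with `1 ≤ l < n` by at most `G_n` times
this size, where `G_n = γ_k` for `n ∈ J_k` (`Data.IsOperator.norm_blockProj_pow_blockProj_le`). Let
`l` be a block `≥ 1` which maximizes `√G_l` times the size. Because `∑ √G_n ≤ 1/2`, the higher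
blocks perturb the orbit in the block `l` by at most half of its size
(`Data.IsOperator.norm_blockProj_pow_sub_le`). Therefore a fixed `l` cannot be dominant for
arbitrarily large `N`, as the orbit would be bounded in that block, and `l → ∞` as `N → ∞`. The size
of the dominant block is bounded below independently of `N`, whereas it is at most the norm of `x`
in the block if `N ≤ a_k`; hence `N > a_k` for large `N`. In `N` steps each coordinate spends at
most a proportion of the order of `δ^{(k)} / a_k` of the time at places where the partial product is
not maximal, and this tends to `0`. So the orbit avoids a fixed ball around `0` for all times
outside a set of density `0` (`Data.IsOperator.not_isUFrequentlyHypercyclic`). Only blocks `n ≥ 1`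
enter, so that the weights of the block `0` are irrelevant.

For the explicit parameters `#J_k γ_k^{1/2} ≤ 2^{-(k+1)}`, because `2^{-τ^{(k)}}` is doubly
exponentially small in `k²` while all other factors are exponential in a polynomial of `k`, with the
exception of `2^{δ^{(k-1)}}`, and `δ^{(k-1)} ≤ τ^{(k)} / 2`.
-/

namespace CType

/-! ### Topological dynamics of linear operators -/

/-- Birkhoff's transitivity theorem, for mixing maps. -/
theorem IsTopologicallyMixing.isHypercyclic {X : Type*} [TopologicalSpace X] [BaireSpace X]
    [SecondCountableTopology X] [Nonempty X] {T : X → X} (hT : Continuous T)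
    (h : IsTopologicallyMixing T) : IsHypercyclic T := by
  have hopen (U : Set X) (hU : IsOpen U) : IsOpen (⋃ i : ℕ, T^[i] ⁻¹' U) :=
    isOpen_iUnion fun i => hU.preimage (hT.iterate i)
  obtain ⟨x, hx⟩ : (⋂ U ∈ {U ∈ TopologicalSpace.countableBasis X | U.Nonempty},
      ⋃ i : ℕ, T^[i] ⁻¹' U).Nonempty := by
    refine Dense.nonempty (dense_biInter_of_isOpen (fun U hU => hopen U
      (TopologicalSpace.isOpen_of_mem_countableBasis hU.1))
      ((TopologicalSpace.countable_countableBasis X).mono fun U hU => hU.1) fun U hU => ?_)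
    refine dense_iff_inter_open.2 fun V hV hVne => ?_
    obtain ⟨i, hi⟩ := (h V U hV hVne (TopologicalSpace.isOpen_of_mem_countableBasis hU.1)
      hU.2).infinite_compl.nonempty
    rw [compl_compl] at hi
    obtain ⟨_, ⟨y, hy, rfl⟩, hyU⟩ := hi
    exact ⟨y, hy, Set.mem_iUnion.2 ⟨i, hyU⟩⟩
  refine ⟨x, (TopologicalSpace.isBasis_countableBasis X).dense_iff.2 fun U hU hUne => ?_⟩
  obtain ⟨i, hi⟩ := Set.mem_iUnion.1 (Set.mem_iInter₂.1 hx U ⟨hU, hUne⟩)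
  exact ⟨_, hi, i, rfl⟩

/-- The vectors which are, for all large `i`, approximated by `T^i z` with `z` small. They form a
subspace, which is closed by `isClosed_reachable`. -/
def reachable {X : Type*} [NormedAddCommGroup X] [NormedSpace ℂ X] (T : X →L[ℂ] X) :
    Submodule ℂ X where
  carrier := {y | ∀ ε > 0, ∀ᶠ i : ℕ in atTop, ∃ z, ‖z‖ < ε ∧ ‖(T ^ i) z - y‖ < ε}
  zero_mem' ε hε := Eventually.of_forall fun i => ⟨0, by simpa using hε⟩
  add_mem' {x y} hx hy ε hε := by
    filter_upwards [hx (ε / 2) (by positivity), hy (ε / 2) (by positivity)]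
    rintro i ⟨z, hz, hz'⟩ ⟨u, hu, hu'⟩
    refine ⟨z + u, by linarith [norm_add_le z u], ?_⟩
    have : (T ^ i) (z + u) - (x + y) = ((T ^ i) z - x) + ((T ^ i) u - y) := by
      rw [map_add]; abel
    rw [this]
    linarith [norm_add_le ((T ^ i) z - x) ((T ^ i) u - y)]
  smul_mem' c y hy ε hε := by
    have hc : 0 < ‖c‖ + 1 := by positivity
    filter_upwards [hy (ε / (‖c‖ + 1)) (by positivity)]
    rintro i ⟨z, hz, hz'⟩
    have key (v : X) (hv : ‖v‖ < ε / (‖c‖ + 1)) : ‖c • v‖ < ε := by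
      rw [norm_smul]
      rw [lt_div_iff₀ hc] at hv
      nlinarith [norm_nonneg v, norm_nonneg c]
    refine ⟨c • z, key z hz, ?_⟩
    rw [map_smul, ← smul_sub]
    exact key _ hz'

section Reachable

variable {X : Type*} [NormedAddCommGroup X] [NormedSpace ℂ X] {T : X →L[ℂ] X}

theorem isClosed_reachable : IsClosed (reachable T : Set X) := by
  refine isClosed_of_closure_subset fun y hy ε hε => ?_
  obtain ⟨y', hy', hd⟩ := Metric.mem_closure_iff.1 hy (ε / 2) (by positivity)
  filter_upwards [hy' (ε / 2) (by positivity)]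
  rintro i ⟨z, hz, hz'⟩
  refine ⟨z, by linarith, ?_⟩
  rw [dist_comm, dist_eq_norm] at hd
  have : (T ^ i) z - y = ((T ^ i) z - y') + (y' - y) := by abel
  rw [this]
  linarith [norm_add_le ((T ^ i) z - y') (y' - y)]

theorem map_mem_reachable {y : X} (hy : y ∈ reachable T) : T y ∈ reachable T := by
  intro ε hε
  have hc : 0 < ‖T‖ + 1 := by positivity
  have hε' : 0 < ε / (‖T‖ + 1) := by positivity
  filter_upwards [hy _ hε']
  rintro i ⟨z, hz, hz'⟩
  have key (v : X) (hv : ‖v‖ < ε / (‖T‖ + 1)) : ‖T v‖ < ε := by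
    rw [lt_div_iff₀ hc] at hv
    nlinarith [norm_nonneg v, norm_nonneg T, T.le_opNorm v]
  refine ⟨T z, key z hz, ?_⟩
  have : (T ^ i) (T z) = T ((T ^ i) z) := by
    rw [← mul_apply_eq_comp, ← mul_apply_eq_comp, ← pow_succ, ← pow_succ']
  rw [this, ← map_sub]
  exact key _ hz'

/-- If every vector is reachable and the periodic points are dense, the operator is mixing: the
orbit of a periodic point `x ∈ U` is finite, so that for all large `i` a small perturbation of `x`
is sent by `T^i` close to a given point of `V`. -/
theorem isTopologicallyMixing_of_reachable (h : reachable T = ⊤)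
    (hper : Dense (Function.periodicPts T)) : IsTopologicallyMixing T := by
  intro U V hU hUne hV hVne
  obtain ⟨x, hxU, n, hn, hx⟩ := dense_iff_inter_open.1 hper U hU hUne
  obtain ⟨y, hy⟩ := hVne
  obtain ⟨ε₁, hε₁, hU'⟩ := Metric.isOpen_iff.1 hU x hxU
  obtain ⟨ε₂, hε₂, hV'⟩ := Metric.isOpen_iff.1 hV y hy
  have hall : ∀ᶠ i : ℕ in atTop, ∀ r ∈ Finset.range n,
      ∃ z, ‖z‖ < min ε₁ ε₂ ∧ ‖(T ^ i) z - (y - T^[r] x)‖ < min ε₁ ε₂ := by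
    rw [Finset.eventually_all]
    intro r _
    have : y - T^[r] x ∈ reachable T := by rw [h]; trivial
    exact this _ (lt_min hε₁ hε₂)
  rw [← Nat.cofinite_eq_atTop, eventually_cofinite] at hall
  refine hall.subset fun i hi hi' => hi ?_
  obtain ⟨z, hz, hz'⟩ := hi' (i % n) (Finset.mem_range.2 (Nat.mod_lt _ hn))
  refine ⟨T^[i] (x + z), ⟨x + z, hU' ?_, rfl⟩, hV' ?_⟩
  · simpa using hz.trans_le (min_le_left _ _)
  · rw [mem_ball_iff_norm]
    have h1 : T^[i] (x + z) - y = (T ^ i) z - (y - T^[i % n] x) := by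
      rw [hx.iterate_mod_apply, ← FunLike.coe_pow_eq_iterate, map_add]
      abel
    rw [h1]
    exact hz'.trans_le (min_le_right _ _)

end Reachable

/-! ### The sequence space and its coordinate blocks -/

section Space

variable {p : ℝ≥0∞} [Fact (1 ≤ p)]

theorem toReal_pos (hp : p ≠ ∞) : 0 < p.toReal :=
  ENNReal.toReal_pos (zero_lt_one.trans_le Fact.out).ne' hp

theorem one_le_toReal (hp : p ≠ ∞) : 1 ≤ p.toReal := by
  simpa using ENNReal.toReal_mono hp (Fact.out : 1 ≤ p)

theorem norm_e (k : ℕ) : ‖e p k‖ = 1 := by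
  rw [e, lp.norm_single (zero_lt_one.trans_le Fact.out), norm_one]

omit [Fact (1 ≤ p)] in
theorem e_apply (k j : ℕ) : (e p k : ℕ → ℂ) j = if j = k then 1 else 0 := by
  rw [e, lp.coeFn_single, Pi.single_apply]

omit [Fact (1 ≤ p)] in
theorem single_eq_smul_e (k : ℕ) (c : ℂ) : lp.single p k c = c • e p k := by
  rw [e, ← lp.single_smul, smul_eq_mul, mul_one]

theorem hasSum_smul_e (hp : p ≠ ∞) (x : Ell p) : HasSum (fun k => (x k : ℂ) • e p k) x := by
  simpa only [single_eq_smul_e] using lp.hasSum_single hp x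

theorem ext_e (hp : p ≠ ∞) {S T : Ell p →L[ℂ] Ell p} (h : ∀ k, S (e p k) = T (e p k)) : S = T := by
  ext1 x
  refine ((hasSum_smul_e hp x).mapL S).unique ?_
  simpa only [map_smul, h] using (hasSum_smul_e hp x).mapL T

theorem topologicalClosure_span_e (hp : p ≠ ∞) :
    (Submodule.span ℂ (Set.range (e p))).topologicalClosure = ⊤ := by
  refine eq_top_iff.2 fun x _ => ?_
  refine mem_closure_of_tendsto (hasSum_smul_e hp x) (Eventually.of_forall fun s => ?_)
  exact Submodule.sum_mem _ fun k _ => Submodule.smul_mem _ _ (Submodule.subset_span ⟨k, rfl⟩)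

theorem secondCountable_ell (hp : p ≠ ∞) : SecondCountableTopology (Ell p) := by
  have h := ((Set.countable_range (e p)).isSeparable.span (R := ℂ)).closure
  have h' := topologicalClosure_span_e (p := p) hp
  rw [← SetLike.coe_set_eq, Submodule.topologicalClosure_coe, Submodule.top_coe] at h'
  rw [h'] at h
  have := TopologicalSpace.isSeparable_univ_iff.1 h
  exact UniformSpace.secondCountable_of_separable _

/-- The coordinate projection of `ℓ_p(ℕ)` onto the span of the `e_k` with `k ∈ s`. -/
noncomputable def proj (p : ℝ≥0∞) [Fact (1 ≤ p)] (s : Finset ℕ) : Ell p →L[ℂ] Ell p :=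
  ∑ k ∈ s, (lp.evalCLM ℂ (fun _ : ℕ => ℂ) p k).smulRight (e p k)

theorem proj_apply (s : Finset ℕ) (x : Ell p) : proj p s x = ∑ k ∈ s, (x k : ℂ) • e p k := by
  rw [proj, sum_apply]
  rfl

theorem proj_e (s : Finset ℕ) (k : ℕ) : proj p s (e p k) = if k ∈ s then e p k else 0 := by
  rw [proj_apply]
  simp [e_apply]

theorem norm_sum_smul_e_rpow (hp : p ≠ ∞) (s : Finset ℕ) (c : ℕ → ℂ) :
    ‖∑ k ∈ s, c k • e p k‖ ^ p.toReal = ∑ k ∈ s, ‖c k‖ ^ p.toReal := by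
  simpa only [single_eq_smul_e] using lp.norm_sum_single (toReal_pos hp) c s

theorem norm_proj_rpow (hp : p ≠ ∞) (s : Finset ℕ) (x : Ell p) :
    ‖proj p s x‖ ^ p.toReal = ∑ k ∈ s, ‖(x k : ℂ)‖ ^ p.toReal := by
  rw [proj_apply, norm_sum_smul_e_rpow hp s fun k => x k]

theorem norm_proj_le (hp : p ≠ ∞) (s : Finset ℕ) (x : Ell p) : ‖proj p s x‖ ≤ ‖x‖ := by
  refine (Real.rpow_le_rpow_iff (norm_nonneg _) (norm_nonneg _) (toReal_pos hp)).1 ?_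
  rw [norm_proj_rpow hp]
  exact lp.sum_rpow_le_norm_rpow (toReal_pos hp) x s

end Space

/-! ### Blocks of C-type data -/

section BlockIndex

variable {b : ℕ → ℕ}

/-- The index `n` of the block `[b_n, b_{n+1})` which contains `j`. -/
def blockIdx (b : ℕ → ℕ) (j : ℕ) : ℕ := Nat.findGreatest (fun n => b n ≤ j) j

theorem b_blockIdx_le (h0 : b 0 = 0) (j : ℕ) : b (blockIdx b j) ≤ j :=
  Nat.findGreatest_spec (P := fun n => b n ≤ j) (Nat.zero_le j) (by simp [h0])

theorem lt_b_blockIdx_succ (hb : StrictMono b) (j : ℕ) : j < b (blockIdx b j + 1) := by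
  by_contra h
  have h' := not_lt.1 h
  have := Nat.le_findGreatest (P := fun n => b n ≤ j) (hb.le_apply.trans h') h'
  exact absurd this (by simp [blockIdx])

theorem blockIdx_eq (hb : StrictMono b) (h0 : b 0 = 0) {n j : ℕ} (h₁ : b n ≤ j)
    (h₂ : j < b (n + 1)) : blockIdx b j = n := by
  have h₃ := hb.lt_iff_lt.1 (h₁.trans_lt (lt_b_blockIdx_succ hb j))
  have h₄ := hb.lt_iff_lt.1 ((b_blockIdx_le h0 j).trans_lt h₂)
  omega

theorem prod_Ioo_add_eq_prod_range {M : Type*} [CommMonoid M] (g : ℕ → M) (m : ℕ) {L : ℕ}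
    (hL : 0 < L) : ∏ j ∈ Finset.Ioo m (m + L), g j =
      ∏ i ∈ Finset.range (L - 1), g (m + (i + 1)) := by
  rw [Finset.range_eq_Ico, Finset.prod_Ico_add' (fun i => g (m + i)), Finset.prod_Ico_add g]
  refine Finset.prod_congr ?_ fun _ _ => rfl
  ext j
  simp only [Finset.mem_Ioo, Finset.mem_Ico]
  omega

end BlockIndex

namespace Data

variable (d : Data)

/-- The length of the block `[b_n, b_{n+1})`. -/
def len (n : ℕ) : ℕ := d.b (n + 1) - d.b n

/-- The product of the first `r` weights `w_{b_n + 1}, …, w_{b_n + r}` of the block `n`. -/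
noncomputable def part (n r : ℕ) : ℂ := ∏ i ∈ Finset.range r, d.w (d.b n + (i + 1))

/-- The coefficient `v_n`, with `v_0` replaced by `0`, which makes the block `0` obey the same
formula as the other ones. -/
noncomputable def coeff (n : ℕ) : ℂ := if n = 0 then 0 else d.v n

/-- The index of the block which contains `j`. -/
def idx (j : ℕ) : ℕ := blockIdx d.b j

theorem len_pos (n : ℕ) : 0 < d.len n := Nat.sub_pos_of_lt (d.b_strictMono n.lt_succ_self)

theorem b_succ (n : ℕ) : d.b (n + 1) = d.b n + d.len n :=
  (Nat.add_sub_of_le (d.b_strictMono n.lt_succ_self).le).symm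

theorem b_idx_le (j : ℕ) : d.b (d.idx j) ≤ j := b_blockIdx_le d.b_zero j

theorem lt_b_idx_succ (j : ℕ) : j < d.b (d.idx j + 1) := lt_b_blockIdx_succ d.b_strictMono j

theorem idx_eq {n j : ℕ} (h₁ : d.b n ≤ j) (h₂ : j < d.b (n + 1)) : d.idx j = n :=
  blockIdx_eq d.b_strictMono d.b_zero h₁ h₂

theorem idx_b (n : ℕ) : d.idx (d.b n) = n := d.idx_eq le_rfl (d.b_strictMono n.lt_succ_self)

theorem exists_eq_b_add (k : ℕ) : ∃ n r, r < d.len n ∧ k = d.b n + r := by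
  have h₁ := d.b_idx_le k
  have h₂ := d.lt_b_idx_succ k
  rw [b_succ] at h₂
  exact ⟨d.idx k, k - d.b (d.idx k), by omega, by omega⟩

theorem w_ne_zero {j : ℕ} (hj : 1 ≤ j) : d.w j ≠ 0 := by
  obtain ⟨c, hc, h⟩ := d.w_bounded_below
  exact norm_pos_iff.1 (hc.trans_le (h j hj))

theorem part_ne_zero (n r : ℕ) : d.part n r ≠ 0 :=
  Finset.prod_ne_zero_iff.2 fun _ _ => d.w_ne_zero (by omega)

theorem part_succ (n r : ℕ) : d.part n (r + 1) = d.part n r * d.w (d.b n + r + 1) := by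
  rw [part, Finset.prod_range_succ, ← part, add_assoc]

theorem blockProd_eq_part (n : ℕ) : d.blockProd n = d.part n (d.len n - 1) := by
  rw [blockProd, part, b_succ, prod_Ioo_add_eq_prod_range _ _ (d.len_pos n)]

theorem blockProd_ne_zero (n : ℕ) : d.blockProd n ≠ 0 := by
  rw [blockProd_eq_part]
  exact d.part_ne_zero _ _

/-! ### Existence and uniqueness of the operator -/

/-- The predecessor of `j` in the cyclic ordering of its block. -/
def pred (j : ℕ) : ℕ := if j = d.b (d.idx j) then d.b (d.idx j + 1) - 1 else j - 1

theorem pred_b (n : ℕ) : d.pred (d.b n) = d.b (n + 1) - 1 := by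
  simp [pred, idx_b]

theorem pred_of_lt {n k : ℕ} (h₁ : d.b n ≤ k) (h₂ : k + 1 < d.b (n + 1)) :
    d.pred (k + 1) = k := by
  have : d.idx (k + 1) = n := d.idx_eq (by omega) h₂
  rw [pred, this, if_neg (by omega), Nat.add_sub_cancel]

theorem pred_injective : Function.Injective d.pred := by
  intro j j' h
  have hb (n : ℕ) : 0 < d.b (n + 1) := by rw [← d.b_zero]; exact d.b_strictMono n.succ_pos
  have key (i i' : ℕ) (hi : i = d.b (d.idx i)) (hi' : i' ≠ d.b (d.idx i')) :
      d.b (d.idx i + 1) - 1 ≠ i' - 1 := by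
    intro hii
    have h0 : i' ≠ 0 := by
      rintro rfl
      refine hi' ?_
      have := d.b_idx_le 0
      omega
    have h1 : i' = d.b (d.idx i + 1) := by have := hb (d.idx i); omega
    exact hi' (by rw [h1, idx_b])
  unfold pred at h
  split_ifs at h with h₁ h₂ h₂
  · have h3 := hb (d.idx j)
    have h4 := hb (d.idx j')
    have h5 := d.b_strictMono.injective (show d.b (d.idx j + 1) = d.b (d.idx j' + 1) by omega)
    rw [h₁, h₂, show d.idx j = d.idx j' by omega]
  · exact absurd h (key _ _ h₁ h₂)
  · exact absurd h.symm (key _ _ h₂ h₁)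
  · have h0 (i : ℕ) (hi : i ≠ d.b (d.idx i)) : i ≠ 0 := by
      rintro rfl
      refine hi ?_
      have := d.b_idx_le 0
      omega
    have := h0 j h₁
    have := h0 j' h₂
    omega

end Data

section Operators

variable {p : ℝ≥0∞} [Fact (1 ≤ p)]

/-- A weighted composition operator with an injective symbol and a bounded weight is bounded on
`ℓ_p(ℕ)`. -/
theorem exists_weightedComposition (hp : p ≠ ∞) {ρ : ℕ → ℕ} (hρ : Function.Injective ρ)
    {c : ℕ → ℂ} {M : ℝ} (hc : ∀ j, ‖c j‖ ≤ M) :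
    ∃ A : Ell p →L[ℂ] Ell p, ∀ j, A (e p (ρ j)) = c j • e p j := by
  have hp0 := toReal_pos hp
  have hM : 0 ≤ M := (norm_nonneg _).trans (hc 0)
  have hbound (x : Ell p) (s : Finset ℕ) :
      ∑ j ∈ s, ‖c j * x (ρ j)‖ ^ p.toReal ≤ (M * ‖x‖) ^ p.toReal := by
    have h1 : ∑ j ∈ s, ‖(x (ρ j) : ℂ)‖ ^ p.toReal ≤ ‖x‖ ^ p.toReal := by
      rw [← Finset.sum_image (f := fun k => ‖(x k : ℂ)‖ ^ p.toReal) (g := ρ)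
        fun _ _ _ _ h => hρ h]
      exact lp.sum_rpow_le_norm_rpow hp0 x _
    rw [Real.mul_rpow hM (norm_nonneg _)]
    refine le_trans ?_ (mul_le_mul_of_nonneg_left h1 (by positivity))
    rw [Finset.mul_sum]
    refine Finset.sum_le_sum fun j _ => ?_
    rw [norm_mul, Real.mul_rpow (norm_nonneg _) (norm_nonneg _)]
    gcongr
    exact hc j
  let A₀ : Ell p →ₗ[ℂ] Ell p :=
    { toFun := fun x => ⟨fun j => c j * x (ρ j), memℓp_gen' (hbound x)⟩
      map_add' := fun x y => by
        ext j
        exact mul_add (c j) (x (ρ j)) (y (ρ j))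
      map_smul' := fun a x => by
        ext j
        simp [mul_left_comm] }
  refine ⟨A₀.mkContinuous M fun x => lp.norm_le_of_forall_sum_le hp0 (by positivity) (hbound x),
    fun j => ?_⟩
  ext i
  simp only [LinearMap.mkContinuous_apply, lp.coeFn_smul, Pi.smul_apply, smul_eq_mul, e_apply]
  change c i * (e p (ρ j) : ℕ → ℂ) (ρ i) = _
  rw [e_apply]
  by_cases h : i = j
  · simp [h]
  · simp [h, hρ.ne h]

/-- An absolutely summable series of rank one operators `v_n e*_{σ n} ⊗ e_{τ n}`. -/
theorem exists_sum_rankOne {v : ℕ → ℂ} (hv : Summable fun n => ‖v n‖) {σ : ℕ → ℕ}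
    (hσ : Function.Injective σ) (τ : ℕ → ℕ) :
    ∃ R : Ell p →L[ℂ] Ell p, (∀ n, R (e p (σ n)) = v n • e p (τ n)) ∧
      ∀ k, (∀ n, σ n ≠ k) → R (e p k) = 0 := by
  let F (n : ℕ) : Ell p →L[ℂ] Ell p :=
    v n • (lp.evalCLM ℂ (fun _ : ℕ => ℂ) p (σ n)).smulRight (e p (τ n))
  have hF (n : ℕ) (x : Ell p) : F n x = v n • (x (σ n) : ℂ) • e p (τ n) := rfl
  have hsum : Summable F := by
    refine Summable.of_norm_bounded hv fun n => ?_
    refine ContinuousLinearMap.opNorm_le_bound _ (norm_nonneg _) fun x => ?_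
    rw [hF, norm_smul, norm_smul, norm_e, mul_one]
    gcongr
    exact lp.norm_apply_le_norm (zero_lt_one.trans_le Fact.out).ne' x _
  have happ (x : Ell p) : HasSum (fun n => F n x) ((∑' n, F n) x) :=
    hsum.hasSum.mapL (ContinuousLinearMap.apply ℂ (Ell p) x)
  refine ⟨∑' n, F n, fun n => (happ _).unique ?_, fun k hk => (happ _).unique ?_⟩
  · have : v n • e p (τ n) = F n (e p (σ n)) := by simp [hF, e_apply]
    rw [this]
    refine hasSum_single n fun m hm => ?_
    simp [hF, e_apply, hσ.ne hm]
  · have : (fun n => F n (e p k)) = fun _ => 0 := by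
      funext n
      simp [hF, e_apply, hk n]
    rw [this]
    exact hasSum_zero

namespace Data

variable (d : Data)

theorem coeff_summable : Summable fun n => ‖d.coeff n‖ := by
  refine (summable_nat_add_iff 1).1 ?_
  simpa [coeff] using d.v_summable

/-- The operator is the sum of a weighted cyclic permutation of each block and of an absolutely
convergent series of rank one operators. -/
theorem exists_isOperator (hp : p ≠ ∞) : ∃ T : Ell p →L[ℂ] Ell p, d.IsOperator p T := by
  obtain ⟨M, hM⟩ := d.w_bounded
  obtain ⟨m, hm, hprod⟩ := d.prod_bounded_below
  obtain ⟨A, hA⟩ := exists_weightedComposition hp d.pred_injective (M := max M m⁻¹)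
    (c := fun j => if j = d.b (d.idx j) then -(d.blockProd (d.idx j))⁻¹ else d.w j) fun j => by
      split_ifs with h
      · rw [norm_neg, norm_inv, blockProd, norm_prod]
        exact (inv_anti₀ hm (hprod _)).trans (le_max_right _ _)
      · refine (hM j ?_).trans (le_max_left _ _)
        by_contra h0
        have := d.b_idx_le j
        omega
  have hb (n : ℕ) : 0 < d.b (n + 1) := by rw [← d.b_zero]; exact d.b_strictMono n.succ_pos
  have hinj : Function.Injective fun n => d.b (n + 1) - 1 := by
    intro n n' h
    have h3 := hb n
    have h4 := hb n'
    have h5 := d.b_strictMono.injective (show d.b (n + 1) = d.b (n' + 1) by dsimp only at h; omega)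
    omega
  obtain ⟨R, hR, hR0⟩ := exists_sum_rankOne (p := p) d.coeff_summable hinj fun n => d.b (d.φ n)
  have hlast (n : ℕ) : (A + R) (e p (d.b (n + 1) - 1)) =
      d.coeff n • e p (d.b (d.φ n)) - (d.blockProd n)⁻¹ • e p (d.b n) := by
    have h := hA (d.b n)
    rw [d.pred_b, idx_b, if_pos rfl] at h
    rw [add_apply, h, hR, neg_smul]
    abel
  refine ⟨A + R, fun n k h₁ h₂ => ?_, fun n hn => ?_, ?_⟩
  · have h := hA (k + 1)
    have hidx : d.idx (k + 1) = n := d.idx_eq (by omega) h₂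
    rw [d.pred_of_lt h₁ h₂, if_neg (by rw [hidx]; omega)] at h
    rw [add_apply, h, hR0, add_zero]
    intro n' h'
    have h3 : k + 1 = d.b (n' + 1) := by have := hb n'; omega
    have h4 : d.idx (k + 1) = n' + 1 := by rw [h3, idx_b]
    obtain rfl : n = n' + 1 := hidx.symm.trans h4
    omega
  · rw [hlast, coeff, if_neg (by omega)]
  · have h := hlast 0
    rw [zero_add] at h
    rw [h, coeff, if_pos rfl, zero_smul, zero_sub, d.b_zero]

namespace IsOperator

variable {d} {T : Ell p →L[ℂ] Ell p} (h : d.IsOperator p T)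
include h

theorem map_block_last (n : ℕ) : T (e p (d.b (n + 1) - 1)) =
    d.coeff n • e p (d.b (d.φ n)) - (d.blockProd n)⁻¹ • e p (d.b n) := by
  rcases Nat.eq_zero_or_pos n with rfl | hn
  · rw [zero_add, h.map_last_zero, coeff, if_pos rfl, zero_smul, zero_sub, d.b_zero]
  · rw [h.map_last n hn, coeff, if_neg hn.ne']

theorem unique (hp : p ≠ ∞) {S : Ell p →L[ℂ] Ell p} (hS : d.IsOperator p S) : S = T := by
  refine ext_e hp fun k => ?_
  obtain ⟨n, r, hr, rfl⟩ := d.exists_eq_b_add k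
  have hb := d.b_succ n
  by_cases hr' : r + 1 < d.len n
  · rw [h.map_inner n _ (by omega) (by omega), hS.map_inner n _ (by omega) (by omega)]
  · rw [show d.b n + r = d.b (n + 1) - 1 by omega, h.map_block_last, hS.map_block_last]

end IsOperator

end Data

end Operators

/-! ### Orbits of the basis vectors -/

theorem pow_add_apply' {X : Type*} [NormedAddCommGroup X] [NormedSpace ℂ X] (T : X →L[ℂ] X)
    (i j : ℕ) (x : X) : (T ^ (i + j)) x = (T ^ i) ((T ^ j) x) := by
  rw [pow_add, mul_apply_eq_comp]

theorem pow_mul_apply_of_fixed {X : Type*} [NormedAddCommGroup X] [NormedSpace ℂ X]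
    {T : X →L[ℂ] X} {x : X} {m : ℕ} (h : (T ^ m) x = x) (t : ℕ) : (T ^ (m * t)) x = x := by
  induction t with
  | zero => simp
  | succ t ih => rw [Nat.mul_succ, pow_add_apply', h, ih]

namespace Data.IsOperator

variable {p : ℝ≥0∞} [Fact (1 ≤ p)] {d : Data} {T : Ell p →L[ℂ] Ell p} (h : d.IsOperator p T)
include h

theorem pow_start (n : ℕ) {r : ℕ} (hr : r < d.len n) :
    (T ^ r) (e p (d.b n)) = d.part n r • e p (d.b n + r) := by
  induction r with
  | zero => simp [part]
  | succ r ih =>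
    have hb := d.b_succ n
    rw [add_comm r 1, pow_add_apply', ih (by omega), map_smul, pow_one,
      h.map_inner n _ (by omega) (by omega), smul_smul, add_comm 1 r, part_succ, add_assoc]

theorem e_eq (n : ℕ) {r : ℕ} (hr : r < d.len n) :
    e p (d.b n + r) = (d.part n r)⁻¹ • (T ^ r) (e p (d.b n)) := by
  rw [h.pow_start n hr, smul_smul, inv_mul_cancel₀ (d.part_ne_zero n r), one_smul]

theorem pow_len (n : ℕ) : (T ^ d.len n) (e p (d.b n)) =
    (d.blockProd n * d.coeff n) • e p (d.b (d.φ n)) - e p (d.b n) := by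
  have hn := d.len_pos n
  obtain ⟨r, hr⟩ := Nat.exists_eq_add_of_le' hn
  have hb : d.b n + r = d.b (n + 1) - 1 := by rw [d.b_succ]; omega
  rw [hr, add_comm r 1, pow_add_apply', h.pow_start n (by omega), map_smul, pow_one, hb,
    h.map_block_last, smul_sub, smul_smul, smul_smul, blockProd_eq_part,
    show d.len n - 1 = r by omega, mul_inv_cancel₀ (d.part_ne_zero n r), one_smul]

theorem pow_two_mul_len (n : ℕ) : (T ^ (2 * d.len n)) (e p (d.b n)) = e p (d.b n) := by
  induction n using Nat.strong_induction_on with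
  | _ n ih =>
    rw [two_mul, pow_add_apply', h.pow_len, map_sub, map_smul, h.pow_len]
    rcases Nat.eq_zero_or_pos n with rfl | hn
    · simp [coeff]
    · obtain ⟨t, ht⟩ := d.b_dvd n hn
      rw [show d.len n = 2 * d.len (d.φ n) * t from ht,
        pow_mul_apply_of_fixed (ih _ (d.φ_lt n hn)) t]
      abel

/-- The coefficient `v_n` is put in front to cover the block `0` as well. -/
theorem coeff_smul_pow_len (n : ℕ) :
    d.coeff n • (T ^ d.len n) (e p (d.b (d.φ n))) = d.coeff n • e p (d.b (d.φ n)) := by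
  rcases Nat.eq_zero_or_pos n with rfl | hn
  · simp [coeff]
  · obtain ⟨t, ht⟩ := d.b_dvd n hn
    rw [show d.len n = 2 * d.len (d.φ n) * t from ht,
      pow_mul_apply_of_fixed (h.pow_two_mul_len _) t]

/-- The orbit of `e_{b_n}`: up to a sign it turns around the block `n`, and during every second turn
it is accompanied by a multiple of the orbit of `e_{b_{φ(n)}}`. -/
theorem pow_mul_len_add (n q r : ℕ) : (T ^ (d.len n * q + r)) (e p (d.b n)) =
    (-1 : ℂ) ^ q • (T ^ r) (e p (d.b n)) +
      if Odd q then (d.blockProd n * d.coeff n) • (T ^ r) (e p (d.b (d.φ n))) else 0 := by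
  induction q with
  | zero => simp
  | succ q ih =>
    have h2 : ∀ q, d.coeff n • (T ^ (d.len n * q + r)) (e p (d.b (d.φ n))) =
        d.coeff n • (T ^ r) (e p (d.b (d.φ n))) := by
      intro q
      induction q with
      | zero => simp
      | succ q ih =>
        rw [show d.len n * (q + 1) + r = d.len n * q + r + d.len n by ring, pow_add_apply',
          ← map_smul, h.coeff_smul_pow_len, map_smul, ih]
    rw [show d.len n * (q + 1) + r = d.len n * q + r + d.len n by ring, pow_add_apply',
      h.pow_len, map_sub, ih, map_smul, mul_smul, h2]
    by_cases hq : Odd q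
    · have : ¬ Odd (q + 1) := Nat.not_odd_iff_even.2 hq.add_one
      rw [if_pos hq, if_neg this, mul_smul, pow_succ]
      simp
    · have : Odd (q + 1) := (Nat.not_odd_iff_even.1 hq).add_one
      rw [if_neg hq, if_pos this, mul_smul, pow_succ]
      simp
      abel

theorem pow_e (n i : ℕ) : (T ^ i) (e p (d.b n)) =
    ((-1 : ℂ) ^ (i / d.len n) * d.part n (i % d.len n)) • e p (d.b n + i % d.len n) +
      if Odd (i / d.len n) then
        (d.blockProd n * d.coeff n) • (T ^ (i % d.len n)) (e p (d.b (d.φ n))) else 0 := by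
  rw [mul_smul, ← h.pow_start n (Nat.mod_lt _ (d.len_pos n)), ← h.pow_mul_len_add,
    Nat.div_add_mod]

/-- All basis vectors are periodic. -/
theorem dense_periodicPts (hp : p ≠ ∞) : Dense (Function.periodicPts T) := by
  have hmem (x : Ell p) : x ∈ Function.periodicPts T ↔ ∃ n > 0, (T ^ n) x = x := by
    simp only [Function.periodicPts, Set.mem_ofPred_eq, Function.IsPeriodicPt, Function.IsFixedPt,
      FunLike.coe_pow_eq_iterate]
  rw [dense_iff_closure_eq, ← Set.univ_subset_iff]
  have htop := topologicalClosure_span_e (p := p) hp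
  rw [← SetLike.coe_set_eq, Submodule.topologicalClosure_coe, Submodule.top_coe] at htop
  rw [← htop]
  refine closure_mono fun x hx => ?_
  refine Submodule.span_induction (p := fun x _ => x ∈ Function.periodicPts T) ?_ ?_ ?_ ?_ hx
  · rintro _ ⟨k, rfl⟩
    obtain ⟨n, r, hr, rfl⟩ := d.exists_eq_b_add k
    refine (hmem _).2 ⟨2 * d.len n, by have := d.len_pos n; omega, ?_⟩
    rw [h.e_eq n hr, map_smul, ← pow_add_apply', add_comm, pow_add_apply', h.pow_two_mul_len]
  · exact (hmem _).2 ⟨1, one_pos, map_zero _⟩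
  · intro x y _ _ hx hy
    obtain ⟨m, hm, hx⟩ := (hmem x).1 hx
    obtain ⟨n, hn, hy⟩ := (hmem y).1 hy
    refine (hmem _).2 ⟨m * n, Nat.mul_pos hm hn, ?_⟩
    rw [map_add, pow_mul_apply_of_fixed hx, mul_comm, pow_mul_apply_of_fixed hy]
  · intro c x _ hx
    obtain ⟨m, hm, hx⟩ := (hmem x).1 hx
    exact (hmem _).2 ⟨m, hm, by rw [map_smul, hx]⟩

/-- To reach all vectors it is enough to reach the first basis vector of each block. -/
theorem reachable_eq_top (hp : p ≠ ∞) (hl : ∀ l, e p (d.b l) ∈ reachable T) :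
    reachable T = ⊤ := by
  refine eq_top_iff.2 ?_
  rw [← topologicalClosure_span_e hp]
  refine Submodule.topologicalClosure_minimal _ (Submodule.span_le.2 ?_) isClosed_reachable
  rintro _ ⟨k, rfl⟩
  obtain ⟨n, r, hr, rfl⟩ := d.exists_eq_b_add k
  rw [h.e_eq n hr]
  refine Submodule.smul_mem _ _ ?_
  have (r : ℕ) : (T ^ r) (e p (d.b n)) ∈ reachable T := by
    induction r with
    | zero => simpa using hl n
    | succ r ih =>
      rw [add_comm, pow_add_apply', pow_one]
      exact map_mem_reachable ih
  exact this r

end Data.IsOperator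

/-! ### Transfer of mass between blocks -/

namespace Data

variable {d : Data} {p : ℝ≥0∞} [Fact (1 ≤ p)]

/-- The projection onto the coordinates in the block `n`. -/
noncomputable def blockProj (d : Data) (p : ℝ≥0∞) [Fact (1 ≤ p)] (n : ℕ) : Ell p →L[ℂ] Ell p :=
  proj p (Finset.Ico (d.b n) (d.b (n + 1)))

theorem blockProj_apply (n : ℕ) (x : Ell p) :
    d.blockProj p n x = ∑ r ∈ Finset.range (d.len n), (x (d.b n + r) : ℂ) • e p (d.b n + r) := by
  rw [blockProj, proj_apply, Finset.sum_Ico_eq_sum_range, len]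

theorem blockProj_e_self (n : ℕ) {r : ℕ} (hr : r < d.len n) :
    d.blockProj p n (e p (d.b n + r)) = e p (d.b n + r) := by
  have := d.b_succ n
  rw [blockProj, proj_e, if_pos (Finset.mem_Ico.2 ⟨by omega, by omega⟩)]

theorem blockProj_e_of_ne {l n : ℕ} (hln : l ≠ n) {r : ℕ} (hr : r < d.len n) :
    d.blockProj p l (e p (d.b n + r)) = 0 := by
  rw [blockProj, proj_e, if_neg]
  intro hmem
  rw [Finset.mem_Ico] at hmem
  have := d.b_succ n
  have h₁ := d.idx_eq hmem.1 hmem.2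
  have h₂ := d.idx_eq (n := n) (j := d.b n + r) (by omega) (by omega)
  omega

theorem norm_blockProj_le (hp : p ≠ ∞) (n : ℕ) (x : Ell p) : ‖d.blockProj p n x‖ ≤ ‖x‖ :=
  norm_proj_le hp _ x

/-- A quantitative control of the transfers from each block `n ≥ 1` to the lower ones. -/
structure Envelope (d : Data) (p : ℝ≥0∞) where
  /-- The largest modulus of a partial product of weights in the block. -/
  β : ℕ → ℝ
  /-- The relative strength of the transfer out of the block. -/
  G : ℕ → ℝ
  /-- The length of the final part of the block where the partial products are maximal. -/
  a : ℕ → ℕ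
  norm_part_le : ∀ n, 1 ≤ n → ∀ r, r < d.len n → ‖d.part n r‖ ≤ β n
  norm_part_eq : ∀ n, 1 ≤ n → ∀ r, r < d.len n → d.len n ≤ r + a n → ‖d.part n r‖ = β n
  a_le : ∀ n, 1 ≤ n → a n ≤ d.len n
  a_tendsto : Tendsto a atTop atTop
  /-- The partial products are maximal on most of the block. -/
  bad_ratio : Tendsto (fun n =>
    (((Finset.range (d.len n)).filter fun r => ‖d.part n r‖ ≠ β n).card : ℝ) / a n) atTop (𝓝 0)
  G_pos : ∀ n, 1 ≤ n → 0 < G n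
  transfer_le : ∀ n, 1 ≤ n → 1 ≤ d.φ n →
    ‖d.v n‖ * β (d.φ n) * (d.len n : ℝ) ^ (1 - 1 / p.toReal) ≤ G n
  sum_sqrt_le : ∀ s : Finset ℕ, (∀ n ∈ s, 1 ≤ n) → ∑ n ∈ s, √(G n) ≤ 1 / 2

namespace Envelope

variable (E : d.Envelope p)

omit [Fact (1 ≤ p)] in
theorem sqrt_G_le_one {n : ℕ} (hn : 1 ≤ n) : √(E.G n) ≤ 1 := by
  have := E.sum_sqrt_le {n} (by simpa using hn)
  rw [Finset.sum_singleton] at this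
  linarith

omit [Fact (1 ≤ p)] in
theorem G_le_one {n : ℕ} (hn : 1 ≤ n) : E.G n ≤ 1 :=
  by
  simpa using (Real.sqrt_le_iff.1 (E.sqrt_G_le_one hn)).2

omit [Fact (1 ≤ p)] in
theorem β_pos {n : ℕ} (hn : 1 ≤ n) : 0 < E.β n :=
  (norm_pos_iff.2 (d.part_ne_zero n 0)).trans_le (E.norm_part_le n hn 0 (d.len_pos n))

end Envelope

theorem one_le_len_rpow (hp : p ≠ ∞) (n : ℕ) : 1 ≤ (d.len n : ℝ) ^ (1 - 1 / p.toReal) := by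
  refine Real.one_le_rpow (by exact_mod_cast d.len_pos n) ?_
  rw [sub_nonneg, div_le_one (toReal_pos hp)]
  exact one_le_toReal hp

namespace IsOperator

variable {T : Ell p →L[ℂ] Ell p} (h : d.IsOperator p T)
include h

/-- Nothing moves from a block to a higher one. -/
theorem blockProj_pow_of_lt {l n : ℕ} (hn : n < l) (i : ℕ) :
    d.blockProj p l ((T ^ i) (e p (d.b n))) = 0 := by
  induction n using Nat.strong_induction_on generalizing i with
  | _ n ih =>
    rw [h.pow_e, map_add, map_smul,
      blockProj_e_of_ne hn.ne' (Nat.mod_lt _ (d.len_pos n)), smul_zero, zero_add]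
    split_ifs with ho
    · rcases Nat.eq_zero_or_pos n with rfl | hn0
      · simp [coeff]
      · rw [map_smul, ih _ (d.φ_lt n hn0) ((d.φ_lt n hn0).trans hn), smul_zero]
    · rw [map_zero]

theorem blockProj_pow_self {l : ℕ} (hl : 1 ≤ l) (i : ℕ) :
    d.blockProj p l ((T ^ i) (e p (d.b l))) =
      ((-1 : ℂ) ^ (i / d.len l) * d.part l (i % d.len l)) • e p (d.b l + i % d.len l) := by
  rw [h.pow_e, map_add, map_smul, blockProj_e_self _ (Nat.mod_lt _ (d.len_pos l))]
  split_ifs with ho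
  · rw [map_smul, h.blockProj_pow_of_lt (d.φ_lt l hl), smul_zero, add_zero]
  · rw [map_zero, add_zero]

theorem norm_blockProj_pow_self_le (E : d.Envelope p) {l : ℕ} (hl : 1 ≤ l) (i : ℕ) :
    ‖d.blockProj p l ((T ^ i) (e p (d.b l)))‖ ≤ E.β l := by
  rw [h.blockProj_pow_self hl, norm_smul, norm_e, mul_one, norm_mul, norm_pow, norm_neg, norm_one,
    one_pow, one_mul]
  exact E.norm_part_le l hl _ (Nat.mod_lt _ (d.len_pos l))

/-- Along a chain `n, φ(n), φ(φ(n)), …` ending in `l` every transfer but the first one is bounded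
by `1`. -/
theorem norm_blockProj_pow_le (hp : p ≠ ∞) (E : d.Envelope p) {l n : ℕ} (hl : 1 ≤ l) (hn : l < n)
    (i : ℕ) : ‖d.blockProj p l ((T ^ i) (e p (d.b n)))‖ * (d.len n : ℝ) ^ (1 - 1 / p.toReal) ≤
      E.β n * E.G n := by
  induction n using Nat.strong_induction_on generalizing i with
  | _ n ih =>
    have hn1 : 1 ≤ n := by omega
    have hβ := E.β_pos hn1
    have hG := E.G_pos n hn1
    rw [h.pow_e, map_add, map_smul,
      blockProj_e_of_ne hn.ne (Nat.mod_lt _ (d.len_pos n)), smul_zero, zero_add]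
    split_ifs with ho
    · rw [map_smul, norm_smul]
      rcases Nat.lt_or_ge (d.φ n) l with hφ | hφ
      · rw [h.blockProj_pow_of_lt hφ, norm_zero, mul_zero, zero_mul]
        positivity
      · have hφ1 : 1 ≤ d.φ n := hl.trans hφ
        have key : ‖d.blockProj p l ((T ^ (i % d.len n)) (e p (d.b (d.φ n))))‖ ≤
            E.β (d.φ n) := by
          rcases hφ.eq_or_lt with hφ | hφ
          · rw [← hφ]
            exact h.norm_blockProj_pow_self_le E hl _
          · refine (le_mul_of_one_le_right (norm_nonneg _) (one_le_len_rpow hp (d.φ n))).trans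
              ((ih _ (d.φ_lt n hn1) hφ _).trans ?_)
            exact mul_le_of_le_one_right (E.β_pos hφ1).le (E.G_le_one hφ1)
        have hW : ‖d.blockProd n * d.coeff n‖ ≤ E.β n * ‖d.v n‖ := by
          rw [norm_mul, coeff, if_neg (by omega), blockProd_eq_part]
          have := d.len_pos n
          exact mul_le_mul_of_nonneg_right (E.norm_part_le n hn1 _ (by omega)) (norm_nonneg _)
        calc _ ≤ E.β n * ‖d.v n‖ * E.β (d.φ n) * (d.len n : ℝ) ^ (1 - 1 / p.toReal) := by
              gcongr
          _ = E.β n * (‖d.v n‖ * E.β (d.φ n) * (d.len n : ℝ) ^ (1 - 1 / p.toReal)) := by ring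
          _ ≤ E.β n * E.G n := by
              gcongr
              exact E.transfer_le n hn1 hφ1
    · rw [map_zero, norm_zero, zero_mul]
      positivity

theorem blockProj_pow_eq_zero {l n i : ℕ} (hn : l ≠ n) (hi : i < d.len n) :
    d.blockProj p l ((T ^ i) (e p (d.b n))) = 0 := by
  rw [h.pow_start n hi, map_smul, blockProj_e_of_ne hn hi, smul_zero]

theorem blockProj_pow_blockProj (l n j : ℕ) (x : Ell p) :
    d.blockProj p l ((T ^ j) (d.blockProj p n x)) = ∑ r ∈ Finset.range (d.len n),
      ((x (d.b n + r) : ℂ) * (d.part n r)⁻¹) •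
        d.blockProj p l ((T ^ (r + j)) (e p (d.b n))) := by
  rw [blockProj_apply n x, map_sum, map_sum]
  refine Finset.sum_congr rfl fun r hr => ?_
  rw [map_smul, map_smul, h.e_eq n (Finset.mem_range.1 hr), map_smul, map_smul, smul_smul,
    ← pow_add_apply', add_comm j r]

end IsOperator

/-! ### The size of a vector in a block -/

namespace Envelope

variable (E : d.Envelope p)

/-- The modulus which the coordinate `b_n + r` of `x` reaches after it has been moved by the
operator to a place of the block `n` where the partial product is maximal. -/
noncomputable def amp (x : Ell p) (n r : ℕ) : ℝ :=
  ‖(x (d.b n + r) : ℂ)‖ * (E.β n / ‖d.part n r‖)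

/-- The places of the block `n` from which the end of the block is reached within `N` steps. -/
def late (d : Data) (n N : ℕ) : Finset ℕ :=
  (Finset.range (d.len n)).filter fun r => d.len n ≤ r + N

/-- The `ℓ_p`-norm of the amplitudes of `x` at the places of the block `n` which reach the end of
the block within `N` steps. -/
noncomputable def size (x : Ell p) (n N : ℕ) : ℝ :=
  (∑ r ∈ late d n N, E.amp x n r ^ p.toReal) ^ (1 / p.toReal)

theorem mem_late {n N r : ℕ} : r ∈ late d n N ↔ r < d.len n ∧ d.len n ≤ r + N := by
  rw [late, Finset.mem_filter, Finset.mem_range]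

omit [Fact (1 ≤ p)] in
theorem amp_nonneg (x : Ell p) {n : ℕ} (hn : 1 ≤ n) (r : ℕ) : 0 ≤ E.amp x n r := by
  have := E.β_pos hn
  unfold amp
  positivity

omit [Fact (1 ≤ p)] in
theorem sum_amp_nonneg (x : Ell p) {n : ℕ} (hn : 1 ≤ n) (s : Finset ℕ) :
    0 ≤ ∑ r ∈ s, E.amp x n r ^ p.toReal :=
  Finset.sum_nonneg fun r _ => Real.rpow_nonneg (E.amp_nonneg x hn r) _

omit [Fact (1 ≤ p)] in
theorem size_nonneg (x : Ell p) {n : ℕ} (hn : 1 ≤ n) (N : ℕ) : 0 ≤ E.size x n N :=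
  Real.rpow_nonneg (E.sum_amp_nonneg x hn _) _

theorem size_rpow (hp : p ≠ ∞) (x : Ell p) {n : ℕ} (hn : 1 ≤ n) (N : ℕ) :
    E.size x n N ^ p.toReal = ∑ r ∈ late d n N, E.amp x n r ^ p.toReal := by
  rw [size, ← Real.rpow_mul (E.sum_amp_nonneg x hn _), one_div,
    inv_mul_cancel₀ (toReal_pos hp).ne', Real.rpow_one]

theorem size_le_of_sum_le (hp : p ≠ ∞) {x : Ell p} {n N : ℕ} (hn : 1 ≤ n) {M : ℝ} (hM : 0 ≤ M)
    (h : ∑ r ∈ late d n N, E.amp x n r ^ p.toReal ≤ M ^ p.toReal) : E.size x n N ≤ M :=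
  (Real.rpow_le_rpow_iff (E.size_nonneg x hn N) hM (toReal_pos hp)).1
    ((E.size_rpow hp x hn N).trans_le h)

theorem size_mono (hp : p ≠ ∞) (x : Ell p) {n : ℕ} (hn : 1 ≤ n) {N N' : ℕ} (hN : N ≤ N') :
    E.size x n N ≤ E.size x n N' := by
  refine E.size_le_of_sum_le hp hn (E.size_nonneg x hn _) ?_
  rw [E.size_rpow hp x hn]
  refine Finset.sum_le_sum_of_subset_of_nonneg (fun r hr => ?_) fun r _ _ =>
    Real.rpow_nonneg (E.amp_nonneg x hn r) _
  rw [mem_late] at hr ⊢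
  omega

theorem size_le_norm_blockProj (hp : p ≠ ∞) (x : Ell p) {n N : ℕ} (hn : 1 ≤ n) (hN : N ≤ E.a n) :
    E.size x n N ≤ ‖d.blockProj p n x‖ := by
  refine E.size_le_of_sum_le hp hn (norm_nonneg _) ?_
  rw [blockProj, norm_proj_rpow hp, Finset.sum_Ico_eq_sum_range]
  refine (Finset.sum_le_sum fun r hr => ?_).trans (Finset.sum_le_sum_of_subset_of_nonneg
    (s := late d n N) (Finset.filter_subset _ _) fun r _ _ => by positivity)
  rw [mem_late] at hr
  rw [amp, E.norm_part_eq n hn r hr.1 (by omega), div_self (E.β_pos hn).ne', mul_one]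

/-- Hölder's inequality. -/
theorem sum_amp_le (hp : p ≠ ∞) (x : Ell p) {n : ℕ} (hn : 1 ≤ n) (N : ℕ) :
    ∑ r ∈ late d n N, E.amp x n r ≤ (d.len n : ℝ) ^ (1 - 1 / p.toReal) * E.size x n N := by
  have hp0 := toReal_pos hp
  have hp1 := one_le_toReal hp
  have hs := E.size_nonneg x hn N
  refine (Real.rpow_le_rpow_iff (Finset.sum_nonneg fun r _ => E.amp_nonneg x hn r)
    (by positivity) hp0).1 ?_
  rw [Real.mul_rpow (by positivity) hs, E.size_rpow hp x hn, ← Real.rpow_mul (by positivity),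
    sub_mul, one_mul, one_div, inv_mul_cancel₀ hp0.ne']
  refine (Real.rpow_sum_le_const_mul_sum_rpow_of_nonneg _ hp1
    fun r _ => E.amp_nonneg x hn r).trans ?_
  refine mul_le_mul_of_nonneg_right (Real.rpow_le_rpow (by positivity) ?_ (by linarith))
    (E.sum_amp_nonneg x hn _)
  exact_mod_cast (Finset.card_filter_le _ _).trans_eq (Finset.card_range _)

end Envelope

end Data

/-! ### Dominant blocks -/

namespace Data

variable {d : Data} {p : ℝ≥0∞} [Fact (1 ≤ p)]

namespace Envelope

variable (E : d.Envelope p)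

omit [Fact (1 ≤ p)] in
theorem sqrt_G_tendsto : Tendsto (fun n => √(E.G n)) atTop (𝓝 0) := by
  refine (tendsto_add_atTop_iff_nat 1).1 ?_
  refine (summable_of_sum_range_le (c := 1 / 2) (fun n => Real.sqrt_nonneg _)
    fun N => ?_).tendsto_atTop_zero
  rw [← Finset.sum_image (f := fun n => √(E.G n)) (g := (· + 1)) fun _ _ _ _ h => by simpa using h]
  exact E.sum_sqrt_le _ (by simp)

/-- For each `N` some block `l` maximizes `√G_l` times the size of `x` in the block. -/
theorem exists_dominant_block (hp : p ≠ ∞) (x : Ell p) (N : ℕ) {n₀ : ℕ} (hn₀ : 1 ≤ n₀)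
    (hpos : 0 < √(E.G n₀) * E.size x n₀ N) :
    ∃ l, 1 ≤ l ∧ ∀ n, 1 ≤ n → √(E.G n) * E.size x n N ≤ √(E.G l) * E.size x l N := by
  set F : ℕ → ℝ := fun n => √(E.G n) * E.size x n N with hF
  have hlim : Tendsto (fun n => √(E.G n) * ‖x‖) atTop (𝓝 0) := by
    simpa using E.sqrt_G_tendsto.mul_const ‖x‖
  obtain ⟨M, hM⟩ := eventually_atTop.1 ((hlim.eventually (gt_mem_nhds hpos)).and
    (E.a_tendsto.eventually_ge_atTop N))
  have hsmall (n : ℕ) (hn : 1 ≤ n) (hMn : M ≤ n) : F n ≤ F n₀ := by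
    obtain ⟨h₁, h₂⟩ := hM n hMn
    refine le_trans ?_ h₁.le
    refine mul_le_mul_of_nonneg_left ?_ (Real.sqrt_nonneg _)
    exact (E.size_le_norm_blockProj hp x hn h₂).trans (norm_blockProj_le hp n x)
  have hmem : n₀ ∈ Finset.Icc 1 (max M n₀) := by simp [hn₀]
  obtain ⟨l, hl, hmax⟩ := (Finset.Icc 1 (max M n₀)).exists_max_image F ⟨n₀, hmem⟩
  refine ⟨l, (Finset.mem_Icc.1 hl).1, fun n hn => ?_⟩
  by_cases hnM : n ≤ max M n₀
  · exact hmax n (Finset.mem_Icc.2 ⟨hn, hnM⟩)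
  · exact (hsmall n hn (by omega)).trans (hmax n₀ hmem)

end Envelope

theorem tendsto_sum_blockProj (hp : p ≠ ∞) (x : Ell p) :
    Tendsto (fun M => ∑ n ∈ Finset.range M, d.blockProj p n x) atTop (𝓝 x) := by
  have h1 (M : ℕ) : ∑ n ∈ Finset.range M, d.blockProj p n x =
      ∑ k ∈ Finset.range (d.b M), (x k : ℂ) • e p k := by
    induction M with
    | zero => simp [d.b_zero]
    | succ M ih =>
      rw [Finset.sum_range_succ, ih, blockProj, proj_apply,
        Finset.sum_range_add_sum_Ico _ (d.b_strictMono M.lt_succ_self).le]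
  simp only [h1]
  exact (hasSum_smul_e hp x).tendsto_sum_nat.comp d.b_strictMono.tendsto_atTop

namespace IsOperator

variable {T : Ell p →L[ℂ] Ell p} (h : d.IsOperator p T)
include h

theorem blockProj_pow_blockProj_of_lt {l n : ℕ} (hn : n < l) (j : ℕ) (x : Ell p) :
    d.blockProj p l ((T ^ j) (d.blockProj p n x)) = 0 := by
  rw [h.blockProj_pow_blockProj]
  exact Finset.sum_eq_zero fun r _ => by rw [h.blockProj_pow_of_lt hn, smul_zero]

/-- The influence of a block on a lower one within `N` steps. -/
theorem norm_blockProj_pow_blockProj_le (hp : p ≠ ∞) (E : d.Envelope p) {l n : ℕ} (hl : 1 ≤ l)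
    (hn : l < n) {j N : ℕ} (hj : j ≤ N) (x : Ell p) :
    ‖d.blockProj p l ((T ^ j) (d.blockProj p n x))‖ ≤ E.G n * E.size x n N := by
  have hn1 : 1 ≤ n := by omega
  have hβ := E.β_pos hn1
  have hL : 0 < (d.len n : ℝ) ^ (1 - 1 / p.toReal) :=
    zero_lt_one.trans_le (one_le_len_rpow hp n)
  have hterm (r : ℕ) : ‖((x (d.b n + r) : ℂ) * (d.part n r)⁻¹) •
      d.blockProj p l ((T ^ (r + j)) (e p (d.b n)))‖ ≤
      E.amp x n r * (E.G n / (d.len n : ℝ) ^ (1 - 1 / p.toReal)) := by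
    rw [norm_smul, norm_mul, norm_inv]
    have h1 : ‖d.blockProj p l ((T ^ (r + j)) (e p (d.b n)))‖ ≤
        E.β n * E.G n / (d.len n : ℝ) ^ (1 - 1 / p.toReal) :=
      (le_div_iff₀ hL).2 (h.norm_blockProj_pow_le hp E hl hn _)
    refine (mul_le_mul_of_nonneg_left h1 (by positivity)).trans_eq ?_
    rw [Envelope.amp]
    ring
  rw [h.blockProj_pow_blockProj, ← Finset.sum_subset (Finset.filter_subset
    (fun r => d.len n ≤ r + N) (Finset.range (d.len n))) fun r hr hr' => by
      rw [h.blockProj_pow_eq_zero hn.ne, smul_zero]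
      simp only [Finset.mem_filter, hr, true_and] at hr'
      omega]
  calc _ ≤ ∑ r ∈ Envelope.late d n N,
        E.amp x n r * (E.G n / (d.len n : ℝ) ^ (1 - 1 / p.toReal)) :=
        norm_sum_le_of_le _ fun r _ => hterm r
    _ ≤ ((d.len n : ℝ) ^ (1 - 1 / p.toReal) * E.size x n N) *
        (E.G n / (d.len n : ℝ) ^ (1 - 1 / p.toReal)) := by
        rw [← Finset.sum_mul]
        exact mul_le_mul_of_nonneg_right (E.sum_amp_le hp x hn1 N)
          (div_nonneg (E.G_pos n hn1).le hL.le)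
    _ = E.G n * E.size x n N := by
        field_simp

/-- In a dominant block the influence of all higher blocks is at most half of the size. -/
theorem norm_blockProj_pow_sub_le (hp : p ≠ ∞) (E : d.Envelope p) {l N : ℕ} (hl : 1 ≤ l)
    {x : Ell p} (hmax : ∀ n, 1 ≤ n → √(E.G n) * E.size x n N ≤ √(E.G l) * E.size x l N)
    {j : ℕ} (hj : j ≤ N) :
    ‖d.blockProj p l ((T ^ j) x) - d.blockProj p l ((T ^ j) (d.blockProj p l x))‖ ≤
      E.size x l N / 2 := by
  have hs := E.size_nonneg x hl N
  set S : Ell p →L[ℂ] Ell p := (d.blockProj p l).comp (T ^ j) with hS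
  change ‖S x - S (d.blockProj p l x)‖ ≤ _
  have hlim := ((S.continuous.tendsto x).comp (tendsto_sum_blockProj (d := d) hp x)).sub_const
    (S (d.blockProj p l x))
  refine le_of_tendsto hlim.norm (eventually_atTop.2 ⟨l + 1, fun M hM => ?_⟩)
  have hlow : ∑ n ∈ Finset.range l, S (d.blockProj p n x) = 0 := Finset.sum_eq_zero fun n hn =>
    h.blockProj_pow_blockProj_of_lt (Finset.mem_range.1 hn) j x
  have hsum : S (∑ n ∈ Finset.range M, d.blockProj p n x) - S (d.blockProj p l x) =
      ∑ n ∈ Finset.Ico (l + 1) M, S (d.blockProj p n x) := by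
    rw [map_sum, ← Finset.sum_range_add_sum_Ico _ hM, Finset.sum_range_succ, hlow]
    abel
  dsimp only [Function.comp]
  rw [hsum]
  have hmem (n : ℕ) (hn : n ∈ Finset.Ico (l + 1) M) : l < n := by
    rw [Finset.mem_Ico] at hn
    omega
  calc _ ≤ ∑ n ∈ Finset.Ico (l + 1) M, √(E.G n) * E.size x l N := by
        refine norm_sum_le_of_le _ fun n hn => ?_
        have hn1 : 1 ≤ n := by have := hmem n hn; omega
        refine (h.norm_blockProj_pow_blockProj_le hp E hl (hmem n hn) hj x).trans ?_
        have h1 : √(E.G n) * E.size x n N ≤ E.size x l N :=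
          (hmax n hn1).trans (mul_le_of_le_one_left hs (E.sqrt_G_le_one hl))
        calc E.G n * E.size x n N = √(E.G n) * (√(E.G n) * E.size x n N) := by
              rw [← mul_assoc, Real.mul_self_sqrt (E.G_pos n hn1).le]
          _ ≤ _ := mul_le_mul_of_nonneg_left h1 (Real.sqrt_nonneg _)
    _ ≤ 1 / 2 * E.size x l N := by
        rw [← Finset.sum_mul]
        refine mul_le_mul_of_nonneg_right (E.sum_sqrt_le _ fun n hn => ?_) hs
        have := hmem n hn
        omega
    _ = E.size x l N / 2 := by ring

theorem exists_norm_blockProj_pow_blockProj_le (E : d.Envelope p) {l : ℕ} (hl : 1 ≤ l)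
    (x : Ell p) : ∃ K, ∀ j, ‖d.blockProj p l ((T ^ j) (d.blockProj p l x))‖ ≤ K := by
  refine ⟨∑ r ∈ Finset.range (d.len l), ‖(x (d.b l + r) : ℂ) * (d.part l r)⁻¹‖ * E.β l,
    fun j => ?_⟩
  rw [h.blockProj_pow_blockProj]
  refine norm_sum_le_of_le _ fun r _ => ?_
  rw [norm_smul]
  exact mul_le_mul_of_nonneg_left (h.norm_blockProj_pow_self_le E hl _) (norm_nonneg _)

/-- The contribution of the coordinates in a block to the orbit in that block is bounded below by
the amplitudes of those coordinates which, at the given time, are at a place with maximal partial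
product. -/
theorem sum_amp_le_norm_blockProj_pow (hp : p ≠ ∞) (E : d.Envelope p) {l : ℕ} (hl : 1 ≤ l)
    (x : Ell p) (j : ℕ) {s : Finset ℕ} (hs : ∀ r ∈ s, r < d.len l)
    (hgood : ∀ r ∈ s, ‖d.part l ((r + j) % d.len l)‖ = E.β l) :
    ∑ r ∈ s, E.amp x l r ^ p.toReal ≤
      ‖d.blockProj p l ((T ^ j) (d.blockProj p l x))‖ ^ p.toReal := by
  have hL := d.len_pos l
  have hinj : Set.InjOn (fun r => d.b l + (r + j) % d.len l) (Finset.range (d.len l)) := by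
    intro r hr r' hr' hrr
    rw [Finset.coe_range, Set.mem_Iio] at hr hr'
    have h1 : (r + j) % d.len l = (r' + j) % d.len l := Nat.add_left_cancel hrr
    have h2 : r ≡ r' [MOD d.len l] := Nat.ModEq.add_right_cancel' j h1
    rwa [Nat.ModEq, Nat.mod_eq_of_lt hr, Nat.mod_eq_of_lt hr'] at h2
  have hsub : s ⊆ Finset.range (d.len l) := fun r hr => Finset.mem_range.2 (hs r hr)
  set c : ℕ → ℂ := fun r => (x (d.b l + r) : ℂ) * (d.part l r)⁻¹ *
    ((-1 : ℂ) ^ ((r + j) / d.len l) * d.part l ((r + j) % d.len l)) with hc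
  have hy : d.blockProj p l ((T ^ j) (d.blockProj p l x)) =
      ∑ r ∈ Finset.range (d.len l), c r • e p (d.b l + (r + j) % d.len l) := by
    rw [h.blockProj_pow_blockProj]
    refine Finset.sum_congr rfl fun r _ => ?_
    rw [h.blockProj_pow_self hl, smul_smul]
  set y := d.blockProj p l ((T ^ j) (d.blockProj p l x)) with hydef
  have hcoord (r : ℕ) (hr : r ∈ s) : (y (d.b l + (r + j) % d.len l) : ℂ) = c r := by
    rw [hy, lp.coeFn_sum, Finset.sum_apply, Finset.sum_eq_single_of_mem r (hsub hr)]
    · simp [e_apply]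
    · intro r' hr' hne
      have : d.b l + (r + j) % d.len l ≠ d.b l + (r' + j) % d.len l :=
        fun hh => hne (hinj (by exact_mod_cast hr') (by exact_mod_cast hsub hr) hh.symm)
      simp only [lp.coeFn_smul, Pi.smul_apply, e_apply, if_neg this, smul_zero]
  calc ∑ r ∈ s, E.amp x l r ^ p.toReal =
        ∑ r ∈ s, ‖(y (d.b l + (r + j) % d.len l) : ℂ)‖ ^ p.toReal := by
        refine Finset.sum_congr rfl fun r hr => ?_
        rw [hcoord r hr, hc]
        dsimp only
        rw [norm_mul, norm_mul, norm_mul, norm_inv, norm_pow, norm_neg, norm_one, one_pow, one_mul,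
          hgood r hr, Envelope.amp]
        congr 1
        ring
    _ = ∑ k ∈ s.image fun r => d.b l + (r + j) % d.len l, ‖(y k : ℂ)‖ ^ p.toReal := by
        rw [Finset.sum_image]
        exact hinj.mono (by exact_mod_cast hsub)
    _ ≤ ‖y‖ ^ p.toReal := lp.sum_rpow_le_norm_rpow (toReal_pos hp) y _

end IsOperator

end Data

/-! ### Failure of `𝒰`-frequent hypercyclicity -/

theorem card_filter_add_mod_mem_le (r N : ℕ) {L : ℕ} (B : Finset ℕ) :
    ((Finset.range N).filter fun j => (r + j) % L ∈ B).card ≤ (N / L + 1) * B.card := by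
  rw [mul_comm, ← Finset.card_range (N / L + 1), ← Finset.card_product]
  refine Finset.card_le_card_of_injOn (fun j => ((r + j) % L, j / L)) (fun j hj => ?_)
    fun j _ j' _ hjj => ?_
  · rw [Finset.mem_coe, Finset.mem_filter, Finset.mem_range] at hj
    rw [Finset.mem_coe, Finset.mem_product, Finset.mem_range]
    exact ⟨hj.2, Nat.lt_succ_of_le (Nat.div_le_div_right hj.1.le)⟩
  · simp only [Prod.mk.injEq] at hjj
    have h1 : j % L = j' % L := Nat.ModEq.add_left_cancel' (n := L) r hjj.1
    rw [← Nat.div_add_mod j L, ← Nat.div_add_mod j' L, h1, hjj.2]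

theorem upperDensity_eq_zero {A : Set ℕ}
    (h : Tendsto (fun N : ℕ => ((A ∩ Set.Iio N).ncard : ℝ) / N) atTop (𝓝 0)) :
    upperDensity A = 0 := h.limsup_eq

namespace Data

variable {d : Data} {p : ℝ≥0∞} [Fact (1 ≤ p)]

omit [Fact (1 ≤ p)] in
theorem Envelope.size_le_size_len (hp0 : 0 < p.toReal) (E : d.Envelope p) (x : Ell p) {l : ℕ}
    (hl : 1 ≤ l) (N : ℕ) : E.size x l N ≤ E.size x l (d.len l) := by
  refine Real.rpow_le_rpow (E.sum_amp_nonneg x hl _) ?_ (by positivity)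
  refine Finset.sum_le_sum_of_subset_of_nonneg (fun r hr => ?_) fun r _ _ =>
    Real.rpow_nonneg (E.amp_nonneg x hl r) _
  rw [Envelope.mem_late] at hr ⊢
  omega

theorem Envelope.size_len_pos (E : d.Envelope p) {x : Ell p} {n : ℕ} (hn : 1 ≤ n)
    (hx : d.blockProj p n x ≠ 0) : 0 < E.size x n (d.len n) := by
  obtain ⟨r, hr, hxr⟩ : ∃ r < d.len n, (x (d.b n + r) : ℂ) ≠ 0 := by
    by_contra! hall
    refine hx ?_
    rw [blockProj_apply]
    exact Finset.sum_eq_zero fun r hr => by rw [hall r (Finset.mem_range.1 hr), zero_smul]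
  refine Real.rpow_pos_of_pos (Finset.sum_pos' (fun r _ =>
    Real.rpow_nonneg (E.amp_nonneg x hn r) _) ⟨r, Envelope.mem_late.2 ⟨hr, by omega⟩, ?_⟩) _
  refine Real.rpow_pos_of_pos (mul_pos (norm_pos_iff.2 hxr) (div_pos (E.β_pos hn) ?_)) _
  exact norm_pos_iff.2 (d.part_ne_zero _ _)

namespace IsOperator

variable {T : Ell p →L[ℂ] Ell p} (h : d.IsOperator p T)
include h

/-- In a dominant block the orbit is of the order of the size of the block at most times, since each
coordinate is at a place with maximal partial product at most times. -/
theorem card_small_le (hp : p ≠ ∞) (E : d.Envelope p) {l N : ℕ} (hl : 1 ≤ l) {x : Ell p}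
    (hmax : ∀ n, 1 ≤ n → √(E.G n) * E.size x n N ≤ √(E.G l) * E.size x l N)
    (hsize : 0 < E.size x l N) (ha : 0 < E.a l) (haN : E.a l ≤ N) :
    (((Finset.range N).filter fun j =>
        ‖d.blockProj p l ((T ^ j) x)‖ < E.size x l N / 4).card : ℝ) ≤
      8 * ((((Finset.range (d.len l)).filter fun r => ‖d.part l r‖ ≠ E.β l).card : ℝ) / E.a l) *
        N := by
  have hp1 := one_le_toReal hp
  set B := (Finset.range (d.len l)).filter fun r => ‖d.part l r‖ ≠ E.β l with hB
  set W := (Finset.range N).filter fun j =>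
    ‖d.blockProj p l ((T ^ j) x)‖ < E.size x l N / 4 with hW
  set u : ℕ → ℝ := fun r => E.amp x l r ^ p.toReal with hu
  have hu0 (r : ℕ) : 0 ≤ u r := Real.rpow_nonneg (E.amp_nonneg x hl r) _
  set S := ∑ r ∈ Envelope.late d l N, u r with hSdef
  have hS : E.size x l N ^ p.toReal = S := E.size_rpow hp x hl N
  have hSpos : 0 < S := hS ▸ Real.rpow_pos_of_pos hsize _
  have hL := d.len_pos l
  -- At a time in `W` at least a quarter of the mass is at a place with small partial product.
  have hbad (j : ℕ) (hj : j ∈ W) :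
      S / 4 ≤ ∑ r ∈ Envelope.late d l N, if (r + j) % d.len l ∈ B then u r else 0 := by
    rw [hW, Finset.mem_filter, Finset.mem_range] at hj
    have h1 := h.norm_blockProj_pow_sub_le hp E hl hmax hj.1.le
    have h2 : ‖d.blockProj p l ((T ^ j) (d.blockProj p l x))‖ ≤ 3 / 4 * E.size x l N := by
      have h3 := norm_sub_norm_le (d.blockProj p l ((T ^ j) (d.blockProj p l x)))
        (d.blockProj p l ((T ^ j) x))
      rw [norm_sub_rev] at h3
      linarith
    have h4 : ∑ r ∈ (Envelope.late d l N).filter (fun r => (r + j) % d.len l ∉ B), u r ≤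
        3 / 4 * S := by
      refine (h.sum_amp_le_norm_blockProj_pow hp E hl x j (fun r hr => ?_) fun r hr => ?_).trans ?_
      · exact (Envelope.mem_late.1 (Finset.mem_filter.1 hr).1).1
      · have := (Finset.mem_filter.1 hr).2
        rw [hB, Finset.mem_filter, Finset.mem_range] at this
        by_contra hne
        exact this ⟨Nat.mod_lt _ hL, hne⟩
      · refine (Real.rpow_le_rpow (norm_nonneg _) h2 (by linarith)).trans ?_
        rw [Real.mul_rpow (by norm_num) hsize.le, hS]
        refine mul_le_mul_of_nonneg_right ?_ hSpos.le
        simpa using Real.rpow_le_rpow_of_exponent_ge (x := 3 / 4) (by norm_num) (by norm_num) hp1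
    have h5 := Finset.sum_filter_add_sum_filter_not (Envelope.late d l N)
      (fun r => (r + j) % d.len l ∈ B) u
    rw [← Finset.sum_filter]
    linarith
  have hcount : (W.card : ℝ) * (S / 4) ≤ S * (((N / d.len l + 1 : ℕ) : ℝ) * B.card) := by
    calc (W.card : ℝ) * (S / 4) = ∑ j ∈ W, S / 4 := by rw [Finset.sum_const, nsmul_eq_mul]
      _ ≤ ∑ j ∈ W, ∑ r ∈ Envelope.late d l N, (if (r + j) % d.len l ∈ B then u r else 0) :=
          Finset.sum_le_sum hbad
      _ ≤ ∑ j ∈ Finset.range N, ∑ r ∈ Envelope.late d l N,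
            (if (r + j) % d.len l ∈ B then u r else 0) :=
          Finset.sum_le_sum_of_subset_of_nonneg (Finset.filter_subset _ _) fun j _ _ =>
            Finset.sum_nonneg fun r _ => by split_ifs <;> simp [hu0]
      _ = ∑ r ∈ Envelope.late d l N,
            (((Finset.range N).filter fun j => (r + j) % d.len l ∈ B).card : ℝ) * u r := by
          rw [Finset.sum_comm]
          refine Finset.sum_congr rfl fun r _ => ?_
          rw [← Finset.sum_filter, Finset.sum_const, nsmul_eq_mul]
      _ ≤ ∑ r ∈ Envelope.late d l N, (((N / d.len l + 1 : ℕ) : ℝ) * B.card) * u r := by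
          refine Finset.sum_le_sum fun r _ => mul_le_mul_of_nonneg_right ?_ (hu0 r)
          exact_mod_cast card_filter_add_mod_mem_le r N B
      _ = S * (((N / d.len l + 1 : ℕ) : ℝ) * B.card) := by
          rw [← Finset.mul_sum, mul_comm]
  have ha' : (0 : ℝ) < E.a l := by exact_mod_cast ha
  have hturns : ((N / d.len l + 1 : ℕ) : ℝ) ≤ 2 * N / E.a l := by
    have h1 : ((N / d.len l : ℕ) : ℝ) ≤ N / E.a l := by
      refine Nat.cast_div_le.trans ?_
      gcongr
      exact E.a_le l hl
    have h2 : (1 : ℝ) ≤ N / E.a l := by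
      rw [le_div_iff₀ ha', one_mul]
      exact_mod_cast haN
    push_cast
    rw [mul_div_assoc]
    linarith
  have h6 : (W.card : ℝ) ≤ 4 * (((N / d.len l + 1 : ℕ) : ℝ) * B.card) := by
    refine le_of_mul_le_mul_right ?_ hSpos
    linarith
  calc (W.card : ℝ) ≤ 4 * (2 * N / E.a l * B.card) := by
        refine h6.trans ?_
        gcongr
    _ = _ := by ring

theorem exists_blockProj_ne_zero (hp : p ≠ ∞) {x : Ell p}
    (hx : ∀ V : Set (Ell p), IsOpen V → V.Nonempty → ∃ j : ℕ, (T ^ j) x ∈ V) :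
    ∃ n, 1 ≤ n ∧ d.blockProj p n x ≠ 0 := by
  by_contra! hall
  have h0 : d.blockProj p 0 x = x := by
    refine tendsto_nhds_unique (tendsto_const_nhds.congr' ?_) (tendsto_sum_blockProj (d := d) hp x)
    filter_upwards [eventually_ge_atTop 1] with M hM
    rw [Finset.sum_eq_single_of_mem 0 (Finset.mem_range.2 hM)]
    exact fun n _ hn => hall n (Nat.one_le_iff_ne_zero.2 hn)
  obtain ⟨j, hj⟩ := hx {y | d.blockProj p 1 y ≠ 0}
    (isOpen_ne.preimage (d.blockProj p 1).continuous)
    ⟨e p (d.b 1 + 0), by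
      change _ ≠ _
      rw [blockProj_e_self 1 (d.len_pos 1), ← norm_ne_zero_iff, norm_e]
      exact one_ne_zero⟩
  exact hj (by rw [← h0, h.blockProj_pow_blockProj_of_lt one_pos])

/-- A fixed block cannot be dominant for arbitrarily large `N`, as the orbit would be bounded in
that block. -/
theorem eventually_not_dominant (hp : p ≠ ∞) (E : d.Envelope p) {x : Ell p}
    (hx : ∀ V : Set (Ell p), IsOpen V → V.Nonempty → ∃ j : ℕ, (T ^ j) x ∈ V) {l : ℕ}
    (hl : 1 ≤ l) : ∀ᶠ N in atTop,
      ¬ ∀ n, 1 ≤ n → √(E.G n) * E.size x n N ≤ √(E.G l) * E.size x l N := by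
  obtain ⟨K, hK⟩ := h.exists_norm_blockProj_pow_blockProj_le E hl x
  set R := K + E.size x l (d.len l) with hR
  obtain ⟨j, hj⟩ := hx {y | R < ‖d.blockProj p l y‖}
    (isOpen_lt continuous_const (d.blockProj p l).continuous.norm)
    ⟨((|R| + 1 : ℝ) : ℂ) • e p (d.b l + 0), by
      change R < ‖d.blockProj p l _‖
      rw [map_smul, blockProj_e_self l (d.len_pos l), norm_smul, norm_e, mul_one,
        Complex.norm_real, Real.norm_eq_abs, abs_of_nonneg (by positivity)]
      linarith [le_abs_self R]⟩
  filter_upwards [eventually_ge_atTop j] with N hN hmax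
  have h1 := h.norm_blockProj_pow_sub_le hp E hl hmax hN
  have h2 := norm_sub_norm_le (d.blockProj p l ((T ^ j) x))
    (d.blockProj p l ((T ^ j) (d.blockProj p l x)))
  have h3 := E.size_le_size_len (toReal_pos hp) x hl N
  have h4 := E.size_nonneg x hl N
  have h5 : R < ‖d.blockProj p l ((T ^ j) x)‖ := hj
  linarith [hK j]

theorem not_isUFrequentlyHypercyclic (hp : p ≠ ∞) (E : d.Envelope p) :
    ¬ IsUFrequentlyHypercyclic T := by
  rintro ⟨x, hxV⟩
  have hpow (j : ℕ) : T^[j] x = (T ^ j) x := by rw [FunLike.coe_pow_eq_iterate]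
  simp only [hpow] at hxV
  have hx (V : Set (Ell p)) (hV : IsOpen V) (hne : V.Nonempty) : ∃ j : ℕ, (T ^ j) x ∈ V := by
    by_contra! hall
    refine (hxV V hV hne).ne' (upperDensity_eq_zero ?_)
    have : {i : ℕ | (T ^ i) x ∈ V} = ∅ := Set.eq_empty_of_forall_notMem hall
    simp only [this, Set.empty_inter, Set.ncard_empty, Nat.cast_zero, zero_div]
    exact tendsto_const_nhds
  obtain ⟨n₀, hn₀, hx₀⟩ := h.exists_blockProj_ne_zero hp hx
  set κ := √(E.G n₀) * E.size x n₀ (d.len n₀) with hκ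
  have hκ0 : 0 < κ := mul_pos (Real.sqrt_pos.2 (E.G_pos n₀ hn₀)) (E.size_len_pos hn₀ hx₀)
  refine (hxV (Metric.ball 0 (κ / 4)) Metric.isOpen_ball
    ⟨0, Metric.mem_ball_self (by positivity)⟩).ne' (upperDensity_eq_zero ?_)
  rw [Metric.tendsto_nhds]
  intro ε hε
  have hratio : ∀ᶠ n in atTop, 8 * ((((Finset.range (d.len n)).filter
      fun r => ‖d.part n r‖ ≠ E.β n).card : ℝ) / E.a n) < ε := by
    have := E.bad_ratio.const_mul 8
    rw [mul_zero] at this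
    exact this.eventually (gt_mem_nhds hε)
  have hproj : ∀ᶠ n in atTop, ‖d.blockProj p n x‖ < κ := by
    have h1 := tendsto_sum_blockProj (d := d) hp x
    have h2 := ((tendsto_add_atTop_iff_nat 1).2 h1).sub h1
    simp only [Finset.sum_range_succ, add_sub_cancel_left, sub_self] at h2
    have h3 := h2.norm
    rw [norm_zero] at h3
    exact h3.eventually (gt_mem_nhds hκ0)
  obtain ⟨M, hM⟩ := eventually_atTop.1
    ((hratio.and hproj).and (E.a_tendsto.eventually_gt_atTop 0))
  -- For large `N` a dominant block has index at least `M`.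
  have hlarge : ∀ᶠ N in atTop, ∀ l ∈ Finset.Icc 1 M,
      ¬ ∀ n, 1 ≤ n → √(E.G n) * E.size x n N ≤ √(E.G l) * E.size x l N :=
    (Finset.eventually_all _).2 fun l hl =>
      h.eventually_not_dominant hp E hx (Finset.mem_Icc.1 hl).1
  filter_upwards [hlarge, eventually_ge_atTop (d.len n₀), eventually_gt_atTop 0] with N hN hN₀ hN1
  have hκN : κ ≤ √(E.G n₀) * E.size x n₀ N :=
    mul_le_mul_of_nonneg_left (E.size_mono hp x hn₀ hN₀) (Real.sqrt_nonneg _)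
  obtain ⟨l, hl, hmax⟩ := E.exists_dominant_block hp x N hn₀ (hκ0.trans_le hκN)
  have hlM : M ≤ l := by
    by_contra! hlM
    exact hN l (Finset.mem_Icc.2 ⟨hl, hlM.le⟩) hmax
  obtain ⟨⟨h₁, h₂⟩, h₃⟩ := hM l hlM
  have hsize : κ ≤ E.size x l N := (hκN.trans (hmax n₀ hn₀)).trans
    (mul_le_of_le_one_left (E.size_nonneg x hl N) (E.sqrt_G_le_one hl))
  -- Otherwise the size of the block would be at most `‖d.blockProj p l x‖ < κ`.
  have haN : E.a l ≤ N := by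
    by_contra! haN
    exact absurd (E.size_le_norm_blockProj hp x hl haN.le) (by linarith)
  have hcard := h.card_small_le hp E hl hmax (hκ0.trans_le hsize) h₃ haN
  have hsub : {i : ℕ | (T ^ i) x ∈ Metric.ball 0 (κ / 4)} ∩ Set.Iio N ⊆
      ((Finset.range N).filter fun j =>
        ‖d.blockProj p l ((T ^ j) x)‖ < E.size x l N / 4 : Finset ℕ) := by
    rintro j ⟨hj, hjN⟩
    rw [Finset.mem_coe, Finset.mem_filter, Finset.mem_range]
    refine ⟨hjN, ?_⟩
    have : ‖(T ^ j) x‖ < κ / 4 := by simpa using hj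
    linarith [norm_blockProj_le (d := d) hp l ((T ^ j) x)]
  have hncard := Set.ncard_le_ncard hsub (Finset.finite_toSet _)
  rw [Set.ncard_coe_finset] at hncard
  have hN1' : (0 : ℝ) < N := by exact_mod_cast hN1
  rw [Real.dist_eq, sub_zero, abs_of_nonneg (by positivity), div_lt_iff₀ hN1']
  calc _ ≤ _ := (Nat.cast_le (α := ℝ)).2 hncard
    _ ≤ _ := hcard
    _ < ε * N := mul_lt_mul_of_pos_right h₁ hN1'

end IsOperator

end Data

/-! ### Combinatorics of the intervals `J_k` -/

namespace Params

variable (P : Params)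

/-- The index `k` of the interval `J_k` which contains `n`. -/
noncomputable def level (n : ℕ) : ℕ := sInf {k | n < P.minJ (k + 1)}

theorem minJ_mono : Monotone P.minJ :=
  monotone_nat_of_le_succ fun k => by simp [minJ, Finset.sum_range_succ]

theorem minJ_zero : P.minJ 0 = 0 := by simp [minJ]

theorem minJ_one : P.minJ 1 = 1 := by simp [minJ, cardJ]

theorem minJ_succ (k : ℕ) (hk : 1 ≤ k) :
    P.minJ (k + 1) = P.minJ k + (P.f k - P.a k) * P.minJ k := by
  have h := P.card_J_of_pos k hk
  simp only [card_J] at h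
  rw [minJ, Finset.sum_range_succ, h]
  rfl

theorem mem_J {n k : ℕ} : n ∈ P.J k ↔ P.minJ k ≤ n ∧ n < P.minJ (k + 1) := Finset.mem_Ico

variable {P}

theorem lt_minJ_level_succ {n : ℕ} (hn : ∃ k, n ∈ P.J k) : n < P.minJ (P.level n + 1) :=
  Nat.sInf_mem (s := {k | n < P.minJ (k + 1)}) (hn.imp fun _ hk => (P.mem_J.1 hk).2)

theorem level_lt {n k : ℕ} (h : n < P.minJ k) : P.level n < k := by
  obtain ⟨k, rfl⟩ := Nat.exists_eq_succ_of_ne_zero (n := k) (by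
    rintro rfl
    simp [minJ_zero] at h)
  exact Nat.lt_succ_of_le (Nat.sInf_le (s := {k | n < P.minJ (k + 1)}) h)

theorem le_level {n k : ℕ} (hn : ∃ k, n ∈ P.J k) (h : P.minJ k ≤ n) : k ≤ P.level n := by
  by_contra! hk
  have := (lt_minJ_level_succ hn).trans_le (P.minJ_mono (Nat.succ_le_of_lt hk))
  omega

theorem minJ_level_le (n : ℕ) : P.minJ (P.level n) ≤ n := by
  by_contra! h
  exact (level_lt h).false

theorem mem_J_level {n : ℕ} (hn : ∃ k, n ∈ P.J k) : n ∈ P.J (P.level n) :=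
  P.mem_J.2 ⟨minJ_level_le n, lt_minJ_level_succ hn⟩

theorem level_eq {n k : ℕ} (h : n ∈ P.J k) : P.level n = k := by
  have h' := P.mem_J.1 h
  have h₁ := level_lt h'.2
  have h₂ := le_level ⟨k, h⟩ h'.1
  omega

theorem one_le_level {n : ℕ} (h : ∃ k, n ∈ P.J k) (hn : 1 ≤ n) : 1 ≤ P.level n :=
  le_level h (P.minJ_one.trans_le hn)

theorem sub_pos_of_mem_J {n k : ℕ} (hk : 1 ≤ k) (h : n ∈ P.J k) : 0 < P.f k - P.a k := by
  rw [mem_J, P.minJ_succ k hk] at h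
  by_contra! h0
  rw [Nat.le_zero.1 h0] at h
  omega

theorem minJ_add_mem_J {k l l' : ℕ} (hk : 1 ≤ k) (hl : l < P.minJ k) (hl' : l' < P.f k - P.a k) :
    P.minJ k + ((P.f k - P.a k) * l + l') ∈ P.J k := by
  rw [mem_J, P.minJ_succ k hk]
  have : (P.f k - P.a k) * (l + 1) ≤ (P.f k - P.a k) * P.minJ k := Nat.mul_le_mul_left _ hl
  rw [Nat.mul_succ] at this
  omega

theorem level_tendsto (h : ∀ n, ∃ k, n ∈ P.J k) : Tendsto P.level atTop atTop :=
  tendsto_atTop.2 fun k => (eventually_ge_atTop (P.minJ k)).mono fun n hn => le_level (h n) hn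

theorem sum_Ico_level (F : ℕ → ℝ) (K : ℕ) :
    ∑ n ∈ Finset.Ico 1 (P.minJ (K + 1)), F (P.level n) =
      ∑ k ∈ Finset.range K, ((P.J (k + 1)).card : ℝ) * F (k + 1) := by
  induction K with
  | zero => simp [minJ_one]
  | succ K ih =>
    have h1 : 1 ≤ P.minJ (K + 1) := P.minJ_one.symm.trans_le (P.minJ_mono (by omega))
    rw [← Finset.sum_Ico_consecutive _ h1 (P.minJ_mono (by omega : K + 1 ≤ K + 1 + 1)), ih,
      Finset.sum_range_succ]
    congr 1
    rw [← nsmul_eq_mul, ← Finset.sum_const]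
    exact Finset.sum_congr rfl fun n hn => by rw [level_eq (k := K + 1) hn]

theorem sum_sqrt_γ_le {p : ℝ≥0∞} (hcond : P.Conditions p) (hcover : ∀ n, ∃ k, n ∈ P.J k) (s : Finset ℕ)
    (hs : ∀ n ∈ s, 1 ≤ n) : ∑ n ∈ s, √(P.γ p (P.level n)) ≤ 1 / 2 := by
  obtain ⟨K, hK⟩ : ∃ K, s ⊆ Finset.Ico 1 (P.minJ (K + 1)) := by
    refine ⟨P.level (s.sup id), fun n hn => Finset.mem_Ico.2 ⟨hs n hn, ?_⟩⟩
    exact (Finset.le_sup (f := id) hn).trans_lt (lt_minJ_level_succ (hcover _))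
  refine (Finset.sum_le_sum_of_subset_of_nonneg hK fun _ _ _ => Real.sqrt_nonneg _).trans ?_
  rw [sum_Ico_level fun k => √(P.γ p k)]
  have := hcond.γ_summable.sum_le_tsum (Finset.range K) fun _ _ => by positivity
  linarith [hcond.γ_sum_le]

theorem eventually_two_zpow_lt {p : ℝ≥0∞} (hcond : P.Conditions p) {ε : ℝ} (hε : 0 < ε) :
    ∀ᶠ k in atTop, (2 : ℝ) ^ (P.τ k - (P.δ k : ℤ)) < ε := by
  obtain ⟨N, hN⟩ := exists_pow_lt_of_lt_one hε (by norm_num : (1 / 2 : ℝ) < 1)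
  filter_upwards [hcond.δ_sub_τ.eventually_ge_atTop (N : ℤ)] with k hk
  calc (2 : ℝ) ^ (P.τ k - (P.δ k : ℤ)) ≤ 2 ^ (-(N : ℤ)) :=
        zpow_le_zpow_right₀ (by norm_num) (by linarith)
    _ = (1 / 2 : ℝ) ^ N := by rw [zpow_neg, zpow_natCast, one_div, inv_pow]
    _ < ε := hN

/-! ### The weights of operators of C₂-type -/

/-- The binary logarithm of the product of the first `r` weights of a block of level `k`. -/
def profile (P : Params) (k l r : ℕ) : ℕ :=
  if r ≤ P.δ k then r
  else if r + P.a k + l + 2 * P.δ k < P.Δ k then P.δ k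
  else if r + P.a k + l + P.δ k < P.Δ k then P.Δ k - P.a k - l - P.δ k - 1 - r
  else if r + P.a k + l < P.Δ k then r + P.a k + l + P.δ k + 1 - P.Δ k
  else P.δ k

theorem profile_le {k l r : ℕ} (_ : P.a k + l + 4 * P.δ k < P.Δ k) :
    P.profile k l r ≤ P.δ k := by
  unfold profile
  split_ifs <;> omega

theorem profile_eq {k l r : ℕ} (_ : P.a k + l + 4 * P.δ k < P.Δ k) (_ : P.δ k ≤ r)
    (_ : r + P.a k + l + 2 * P.δ k < P.Δ k ∨ P.Δ k ≤ r + P.a k + l) :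
    P.profile k l r = P.δ k := by
  unfold profile
  split_ifs <;> omega

theorem two_pow_profile_succ {k l r : ℕ} (h : P.a k + l + 4 * P.δ k < P.Δ k) :
    (2 : ℂ) ^ P.profile k l (r + 1) = 2 ^ P.profile k l r * P.weight k l (r + 1) := by
  have hup (h' : P.profile k l (r + 1) = P.profile k l r + 1) :
      (2 : ℂ) ^ P.profile k l (r + 1) = 2 ^ P.profile k l r * 2 := by rw [h', pow_succ]
  have heq (h' : P.profile k l (r + 1) = P.profile k l r) :
      (2 : ℂ) ^ P.profile k l (r + 1) = 2 ^ P.profile k l r * 1 := by rw [h', mul_one]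
  have hdown (h' : P.profile k l (r + 1) + 1 = P.profile k l r) :
      (2 : ℂ) ^ P.profile k l (r + 1) = 2 ^ P.profile k l r * (1 / 2) := by
    rw [← h', pow_succ]
    ring
  unfold weight
  split_ifs
  · refine hup ?_
    unfold profile
    split_ifs <;> omega
  · refine heq ?_
    unfold profile
    split_ifs <;> omega
  · refine hdown ?_
    unfold profile
    split_ifs <;> omega
  · refine hup ?_
    unfold profile
    split_ifs <;> omega
  · refine heq ?_
    unfold profile
    split_ifs <;> omega

theorem prod_weight {k l : ℕ} (h : P.a k + l + 4 * P.δ k < P.Δ k) (r : ℕ) :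
    ∏ i ∈ Finset.range r, P.weight k l (i + 1) = 2 ^ P.profile k l r := by
  induction r with
  | zero => simp [profile]
  | succ r ih => rw [Finset.prod_range_succ, ih, two_pow_profile_succ h]

theorem card_profile_ne_le {k l : ℕ} (h : P.a k + l + 4 * P.δ k < P.Δ k) :
    ((Finset.range (P.Δ k)).filter fun r => P.profile k l r ≠ P.δ k).card ≤ 3 * P.δ k := by
  have hsub : ((Finset.range (P.Δ k)).filter fun r => P.profile k l r ≠ P.δ k) ⊆
      Finset.range (P.δ k) ∪
        Finset.Ico (P.Δ k - P.a k - l - 2 * P.δ k) (P.Δ k - P.a k - l) := by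
    intro r hr
    rw [Finset.mem_filter] at hr
    rw [Finset.mem_union, Finset.mem_range, Finset.mem_Ico]
    by_contra! hr'
    refine hr.2 (profile_eq h (by omega) ?_)
    omega
  refine (Finset.card_le_card hsub).trans ((Finset.card_union_le _ _).trans ?_)
  rw [Finset.card_range, Nat.card_Ico]
  omega

namespace IsC2Type

variable {d : Data} (hC : P.IsC2Type d)
include hC

theorem add_lt {n k : ℕ} (hk : 1 ≤ k) (hn : n ∈ P.J k) :
    P.a k + (n - P.minJ k) % (P.f k - P.a k) + 4 * P.δ k < P.Δ k := by
  have h₁ := Nat.mod_lt (n - P.minJ k) (sub_pos_of_mem_J hk hn)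
  have h₂ := hC.f_lt k hk
  omega

theorem len_eq {n k : ℕ} (hk : 1 ≤ k) (hn : n ∈ P.J k) : d.len n = P.Δ k := hC.b_eq k hk n hn

theorem part_eq {n k : ℕ} (hk : 1 ≤ k) (hn : n ∈ P.J k) {r : ℕ} (hr : r < P.Δ k) :
    d.part n r = 2 ^ P.profile k ((n - P.minJ k) % (P.f k - P.a k)) r := by
  rw [Data.part, ← prod_weight (hC.add_lt hk hn)]
  refine Finset.prod_congr rfl fun i hi => hC.w_eq k hk n hn _ (by omega) ?_
  have := Finset.mem_range.1 hi
  omega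

theorem norm_part_eq {n k : ℕ} (hk : 1 ≤ k) (hn : n ∈ P.J k) {r : ℕ} (hr : r < P.Δ k) :
    ‖d.part n r‖ = 2 ^ P.profile k ((n - P.minJ k) % (P.f k - P.a k)) r := by
  rw [hC.part_eq hk hn hr, norm_pow, RCLike.norm_ofNat]

theorem blockProd_eq {n k : ℕ} (hk : 1 ≤ k) (hn : n ∈ P.J k) :
    d.blockProd n = 2 ^ P.δ k := by
  have h₁ := hC.add_lt hk hn
  have h₂ : 0 < d.len n := d.len_pos n
  rw [hC.len_eq hk hn] at h₂
  rw [d.blockProd_eq_part, hC.len_eq hk hn, hC.part_eq hk hn (by omega)]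
  rcases Nat.eq_zero_or_pos (P.a k + (n - P.minJ k) % (P.f k - P.a k)) with h0 | h0
  · congr 1
    unfold profile
    split_ifs <;> omega
  · rw [profile_eq h₁ (by omega) (Or.inr (by omega))]

theorem φ_lt_minJ {n k : ℕ} (hk : 1 ≤ k) (hn : n ∈ P.J k) : d.φ n < P.minJ k := by
  rw [hC.φ_eq k hk n hn, Nat.div_lt_iff_lt_mul (sub_pos_of_mem_J hk hn)]
  rw [mem_J, P.minJ_succ k hk, mul_comm] at hn
  omega

theorem norm_v_eq {n k : ℕ} (hk : 1 ≤ k) (hn : n ∈ P.J k) : ‖d.v n‖ = 2 ^ (-P.τ k) := by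
  rw [hC.v_eq k hk n hn, norm_zpow, RCLike.norm_ofNat]

theorem Δ_pos {k : ℕ} (hk : 1 ≤ k) : 0 < P.Δ k := by
  have := hC.f_lt k hk
  omega

theorem γ_pos (p : ℝ≥0∞) {k : ℕ} (hk : 1 ≤ k) : 0 < P.γ p k := by
  have : (0 : ℝ) < P.Δ k := by exact_mod_cast hC.Δ_pos hk
  unfold γ
  positivity

/-! ### Mixing of operators of C₂-type -/

variable {p : ℝ≥0∞} [Fact (1 ≤ p)]

/-- For each large time `i` there is a block `n` of large level with `φ(n) = l` in which the last
run of weights `2` starts `i` steps before the end of the block. A small multiple of the basis vector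
at that place is sent by `T^i` close to `e_{b_l}`. -/
theorem e_mem_reachable (hcond : P.Conditions p) {T : Ell p →L[ℂ] Ell p} (hT : d.IsOperator p T)
    (l : ℕ) : e p (d.b l) ∈ reachable T := by
  intro ε hε
  obtain ⟨k₀, hk₀⟩ := hC.J_cover l
  obtain ⟨K, hK⟩ := eventually_atTop.1 (((eventually_two_zpow_lt hcond
    (half_pos hε)).and (eventually_ge_atTop (k₀ + 1))))
  have hcof : ∀ᶠ i in atTop, i ∈ ⋃ k ∈ Set.Ici 1, Set.Ico (P.a k + P.δ k) (P.f k + P.δ k) := by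
    rw [← Nat.cofinite_eq_atTop, eventually_cofinite]
    exact hcond.cofinite
  have hlarge : ∀ᶠ i in atTop, ∀ k ∈ Finset.range K, P.f k + P.δ k ≤ i :=
    (Finset.eventually_all _).2 fun k _ => eventually_ge_atTop _
  filter_upwards [hcof, hlarge, eventually_ge_atTop 1] with i hi hi' hi1
  simp only [Set.mem_iUnion, Set.mem_Ici, Set.mem_Ico, exists_prop] at hi
  obtain ⟨k, hk, hik, hik'⟩ := hi
  have hKk : K ≤ k := by
    by_contra! hkK
    have := hi' k (Finset.mem_range.2 hkK)
    omega
  obtain ⟨hsmall, hk₀k⟩ := hK k hKk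
  obtain ⟨l', hl'⟩ := Nat.exists_eq_add_of_le hik
  have hlt : l' < P.f k - P.a k := by omega
  have hlJ : l < P.minJ k := (P.mem_J.1 hk₀).2.trans_le (P.minJ_mono hk₀k)
  set n := P.minJ k + ((P.f k - P.a k) * l + l') with hn
  have hnJ : n ∈ P.J k := minJ_add_mem_J hk hlJ hlt
  have hsub : n - P.minJ k = (P.f k - P.a k) * l + l' := by omega
  have hφ : d.φ n = l := by
    rw [hC.φ_eq k hk n hnJ, hsub, Nat.mul_add_div (by omega), Nat.div_eq_of_lt hlt, add_zero]
  have hmod : (n - P.minJ k) % (P.f k - P.a k) = l' := by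
    rw [hsub, Nat.mul_add_mod, Nat.mod_eq_of_lt hlt]
  have hadd := hC.add_lt hk hnJ
  rw [hmod] at hadd
  have hlen := hC.len_eq hk hnJ
  have hn0 : n ≠ 0 := by omega
  have hc : d.blockProd n * d.coeff n ≠ 0 :=
    mul_ne_zero (d.blockProd_ne_zero n) (by
      rw [Data.coeff, if_neg hn0]
      exact d.v_ne_zero n (by omega))
  have hcnorm : ‖(d.blockProd n * d.coeff n)⁻¹‖ = 2 ^ (P.τ k - (P.δ k : ℤ)) := by
    rw [norm_inv, norm_mul, Data.coeff, if_neg hn0, hC.norm_v_eq hk hnJ, hC.blockProd_eq hk hnJ,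
      norm_pow, RCLike.norm_ofNat, ← zpow_natCast, ← zpow_add₀ (by norm_num), ← zpow_neg]
    congr 1
    ring
  refine ⟨(d.blockProd n * d.coeff n)⁻¹ • (T ^ (P.Δ k - i)) (e p (d.b n)), ?_, ?_⟩
  · rw [hT.pow_start n (by omega), norm_smul, norm_smul, norm_e, mul_one, hcnorm,
      hC.norm_part_eq hk hnJ (by omega), hmod]
    have hprof : P.profile k l' (P.Δ k - i) ≤ 1 := by
      unfold profile
      split_ifs <;> omega
    have : (2 : ℝ) ^ P.profile k l' (P.Δ k - i) ≤ 2 ^ 1 := pow_le_pow_right₀ (by norm_num) hprof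
    have hpos : (0 : ℝ) < 2 ^ (P.τ k - (P.δ k : ℤ)) := by positivity
    nlinarith
  · rw [map_smul, ← pow_add_apply', show i + (P.Δ k - i) = d.len n by omega, hT.pow_len, smul_sub,
      smul_smul, inv_mul_cancel₀ hc, one_smul, hφ, sub_sub_cancel_left, norm_neg, norm_smul, norm_e,
      mul_one, hcnorm]
    linarith

/-! ### The envelope of an operator of C₂-type -/

omit [Fact (1 ≤ p)] in
theorem δ_tendsto (hcond : P.Conditions p) : Tendsto P.δ atTop atTop := by
  have h1 : Tendsto (fun k => (P.δ k : ℤ)) atTop atTop := by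
    refine tendsto_atTop_mono' atTop ?_ (tendsto_atTop_add_const_right atTop (P.τ 1) hcond.δ_sub_τ)
    filter_upwards [eventually_ge_atTop 1] with k hk
    have := hC.τ_mono (Set.mem_Ici.2 le_rfl) (Set.mem_Ici.2 hk) hk
    linarith
  exact tendsto_natCast_atTop_iff.1 h1

omit [Fact (1 ≤ p)] in
theorem a_tendsto (hcond : P.Conditions p) : Tendsto P.a atTop atTop := by
  refine tendsto_atTop_mono' atTop ?_ (hC.δ_tendsto hcond)
  filter_upwards [hcond.a_pos, hcond.δ_div_a.eventually (gt_mem_nhds one_pos)] with k h₁ h₂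
  rw [div_lt_one (by exact_mod_cast h₁)] at h₂
  exact_mod_cast h₂.le

/-- The control of the transfers: the partial products of a block of level `k` are at most
`2^{δ^{(k)}}`, and the strength of its transfers is `γ_k`. -/
noncomputable def envelope (hcond : P.Conditions p) : d.Envelope p where
  β n := 2 ^ P.δ (P.level n)
  G n := P.γ p (P.level n)
  a n := P.a (P.level n)
  norm_part_le n hn r hr := by
    have hk := one_le_level (hC.J_cover n) hn
    have hJ := mem_J_level (hC.J_cover n)
    rw [hC.len_eq hk hJ] at hr
    rw [hC.norm_part_eq hk hJ hr]
    exact pow_le_pow_right₀ (by norm_num) (profile_le (hC.add_lt hk hJ))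
  norm_part_eq n hn r hr hra := by
    have hk := one_le_level (hC.J_cover n) hn
    have hJ := mem_J_level (hC.J_cover n)
    rw [hC.len_eq hk hJ] at hr hra
    have hadd := hC.add_lt hk hJ
    have hf := hC.f_lt _ hk
    have ha := hC.a_le_f _ hk
    rw [hC.norm_part_eq hk hJ hr, profile_eq hadd (by omega) (Or.inr (by omega))]
  a_le n hn := by
    have hk := one_le_level (hC.J_cover n) hn
    have hJ := mem_J_level (hC.J_cover n)
    rw [hC.len_eq hk hJ]
    have hf := hC.f_lt _ hk
    have ha := hC.a_le_f _ hk
    omega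
  a_tendsto := (hC.a_tendsto hcond).comp (level_tendsto hC.J_cover)
  bad_ratio := by
    have h1 := (hcond.δ_div_a.const_mul 3).comp (level_tendsto hC.J_cover)
    rw [mul_zero] at h1
    refine squeeze_zero' (Eventually.of_forall fun n => by positivity) ?_ h1
    filter_upwards [eventually_ge_atTop 1] with n hn
    have hk := one_le_level (hC.J_cover n) hn
    have hJ := mem_J_level (hC.J_cover n)
    dsimp only [Function.comp]
    rw [← mul_div_assoc]
    refine div_le_div_of_nonneg_right ?_ (by positivity)
    rw [hC.len_eq hk hJ]
    have h2 := card_profile_ne_le (hC.add_lt hk hJ)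
    suffices h3 : ((Finset.range (P.Δ (P.level n))).filter
        fun r => ‖d.part n r‖ ≠ 2 ^ P.δ (P.level n)).card ≤ 3 * P.δ (P.level n) by
      exact_mod_cast h3
    refine (Finset.card_le_card fun r hr => ?_).trans h2
    rw [Finset.mem_filter] at hr ⊢
    refine ⟨hr.1, fun h => hr.2 ?_⟩
    rw [hC.norm_part_eq hk hJ (Finset.mem_range.1 hr.1), h]
  G_pos n hn := hC.γ_pos p (one_le_level (hC.J_cover n) hn)
  transfer_le n hn hφ := by
    have hk := one_le_level (hC.J_cover n) hn
    have hJ := mem_J_level (hC.J_cover n)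
    have hlevel := level_lt (hC.φ_lt_minJ hk hJ)
    have hφk := one_le_level (hC.J_cover (d.φ n)) hφ
    have hδ : P.δ (P.level (d.φ n)) ≤ P.δ (P.level n - 1) :=
      hC.δ_mono (Set.mem_Ici.2 hφk) (Set.mem_Ici.2 (by omega)) (by omega)
    rw [hC.len_eq hk hJ, hC.norm_v_eq hk hJ, γ]
    refine mul_le_mul_of_nonneg_right ?_ (by positivity)
    rw [← zpow_natCast, ← zpow_add₀ (by norm_num)]
    exact zpow_le_zpow_right₀ (by norm_num) (by omega)
  sum_sqrt_le := sum_sqrt_γ_le hcond hC.J_cover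

theorem dynamics (hp : p ≠ ∞) (hcond : P.Conditions p) :
    (∃! T : Ell p →L[ℂ] Ell p, d.IsOperator p T) ∧
      ∀ T : Ell p →L[ℂ] Ell p, d.IsOperator p T →
        IsChaotic T ∧ IsTopologicallyMixing T ∧ ¬ IsUFrequentlyHypercyclic T := by
  refine ⟨?_, fun T hT => ?_⟩
  · obtain ⟨T, hT⟩ := d.exists_isOperator hp
    exact ⟨T, hT, fun S hS => hT.unique hp hS⟩
  · have hper := hT.dense_periodicPts hp
    have hmix : IsTopologicallyMixing T := isTopologicallyMixing_of_reachable
      (hT.reachable_eq_top hp fun l => hC.e_mem_reachable hcond hT l) hper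
    have := secondCountable_ell hp
    exact ⟨⟨hmix.isHypercyclic T.continuous, hper⟩, hmix,
      hT.not_isUFrequentlyHypercyclic hp (hC.envelope hcond)⟩

end IsC2Type

end Params

/-! ### Existence of C₂-type data -/

namespace Params

variable {P : Params}

theorem norm_weight_le (k l i : ℕ) : ‖P.weight k l i‖ ≤ 2 := by
  unfold weight
  split_ifs <;> norm_num

theorem le_norm_weight (k l i : ℕ) : 1 / 2 ≤ ‖P.weight k l i‖ := by
  unfold weight
  split_ifs <;> norm_num

theorem two_zpow_neg_τ_le_sqrt_γ {p : ℝ≥0∞} [Fact (1 ≤ p)] (hp : p ≠ ∞) {k : ℕ} (hΔ : 0 < P.Δ k)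
    (hγ : √(P.γ p k) ≤ 1) : (2 : ℝ) ^ (-P.τ k) ≤ √(P.γ p k) := by
  have h0 : 0 ≤ P.γ p k := by
    unfold γ
    positivity
  have h1 : (2 : ℝ) ^ (-P.τ k) ≤ P.γ p k := by
    have h2 : (1 : ℝ) ≤ (P.Δ k : ℝ) ^ (1 - 1 / p.toReal) := by
      refine Real.one_le_rpow (by exact_mod_cast hΔ) ?_
      rw [sub_nonneg, div_le_one (toReal_pos hp)]
      exact one_le_toReal hp
    refine le_trans ?_ (le_mul_of_one_le_right (by positivity) h2)
    exact zpow_le_zpow_right₀ (by norm_num) (by omega)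
  refine h1.trans ?_
  calc P.γ p k = √(P.γ p k) * √(P.γ p k) := (Real.mul_self_sqrt h0).symm
    _ ≤ √(P.γ p k) * 1 := mul_le_mul_of_nonneg_left hγ (Real.sqrt_nonneg _)
    _ = √(P.γ p k) := mul_one _

theorem exists_mem_J (hpos : ∀ k, 1 ≤ k → P.a k < P.f k) (n : ℕ) : ∃ k, n ∈ P.J k := by
  have hge (k : ℕ) : k ≤ P.minJ k := by
    induction k with
    | zero => exact Nat.zero_le _
    | succ k ih =>
      rcases Nat.eq_zero_or_pos k with rfl | hk
      · exact P.minJ_one.ge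
      · have := Nat.mul_pos (Nat.sub_pos_of_lt (hpos k hk)) (hk.trans_le ih)
        rw [P.minJ_succ k hk]
        omega
  exact ⟨P.level n, P.mem_J.2 ⟨minJ_level_le n,
    Nat.sInf_mem (s := {k | n < P.minJ (k + 1)}) ⟨n, hge (n + 1)⟩⟩⟩

/-- Data of C₂-type, with a block `0` of length `1`, exist as soon as the lengths of the blocks are
compatible and the coefficients `v_n` are summable. -/
theorem exists_isC2Type (a_mono : MonotoneOn P.a (Set.Ici 1)) (f_mono : MonotoneOn P.f (Set.Ici 1))
    (δ_mono : MonotoneOn P.δ (Set.Ici 1)) (τ_mono : MonotoneOn P.τ (Set.Ici 1))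
    (Δ_mono : MonotoneOn P.Δ (Set.Ici 1)) (a_lt_f : ∀ k, 1 ≤ k → P.a k < P.f k)
    (f_lt : ∀ k, 1 ≤ k → P.f k + 4 * P.δ k < P.Δ k) (two_dvd : ∀ k, 1 ≤ k → 2 ∣ P.Δ k)
    (Δ_dvd : ∀ i k, 1 ≤ i → i < k → 2 * P.Δ i ∣ P.Δ k)
    (hsum : Summable fun n => (2 : ℝ) ^ (-P.τ (P.level (n + 1)))) :
    ∃ d : Data, P.IsC2Type d := by
  have hcover := exists_mem_J a_lt_f
  have hJ (n : ℕ) := mem_J_level (hcover n)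
  have hlevel {n : ℕ} (hn : 1 ≤ n) : 1 ≤ P.level n := one_le_level (hcover n) hn
  have hne {n k : ℕ} (hk : 1 ≤ k) (hn : n ∈ P.J k) : n ≠ 0 := by
    rintro rfl
    have := (P.mem_J.1 hn).1.trans' (P.minJ_mono hk)
    rw [minJ_one] at this
    omega
  set len : ℕ → ℕ := fun n => if n = 0 then 1 else P.Δ (P.level n) with hlen
  have hlen_pos (n : ℕ) : 0 < len n := by
    rw [hlen]
    dsimp only
    split_ifs with hn
    · exact one_pos
    · have := f_lt _ (hlevel (Nat.one_le_iff_ne_zero.2 hn))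
      omega
  have hlen_eq {n k : ℕ} (hk : 1 ≤ k) (hn : n ∈ P.J k) : len n = P.Δ k := by
    rw [hlen]
    dsimp only
    rw [if_neg (hne hk hn), level_eq hn]
  set b : ℕ → ℕ := fun n => ∑ i ∈ Finset.range n, len i with hb
  have hb_succ (n : ℕ) : b (n + 1) = b n + len n := Finset.sum_range_succ _ _
  have hb0 : b 0 = 0 := Finset.sum_range_zero _
  have hb_mono : StrictMono b := strictMono_nat_of_lt_succ fun n => by
    rw [hb_succ]
    exact Nat.lt_add_of_pos_right (hlen_pos n)
  set m : ℕ → ℕ := fun n => P.f (P.level n) - P.a (P.level n) with hm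
  set w : ℕ → ℂ := fun j => P.weight (P.level (blockIdx b j))
    ((blockIdx b j - P.minJ (P.level (blockIdx b j))) % m (blockIdx b j)) (j - b (blockIdx b j))
    with hw
  have hw_eq {n i : ℕ} (hi : i < len n) :
      w (b n + i) = P.weight (P.level n) ((n - P.minJ (P.level n)) % m n) i := by
    have : blockIdx b (b n + i) = n :=
      blockIdx_eq hb_mono hb0 (by omega) (by rw [hb_succ]; omega)
    rw [hw]
    dsimp only
    rw [this, Nat.add_sub_cancel_left]
  set φ : ℕ → ℕ := fun n => if n = 0 then 0 else (n - P.minJ (P.level n)) / m n with hφ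
  have hφ_eq {n k : ℕ} (hk : 1 ≤ k) (hn : n ∈ P.J k) :
      φ n = (n - P.minJ k) / (P.f k - P.a k) := by
    rw [hφ]
    dsimp only
    rw [if_neg (hne hk hn), hm]
    dsimp only
    rw [level_eq hn]
  have hφ_lt {n : ℕ} (hn : 1 ≤ n) : φ n < P.minJ (P.level n) := by
    have h1 := hJ n
    rw [hφ_eq (hlevel hn) (hJ n), Nat.div_lt_iff_lt_mul (sub_pos_of_mem_J (hlevel hn) (hJ n))]
    rw [mem_J, P.minJ_succ _ (hlevel hn), mul_comm] at h1
    omega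
  refine ⟨⟨fun n => (2 : ℂ) ^ (-P.τ (P.level n)), w, φ, b, ?_, ?_, ?_, ?_, ?_, ?_, ?_, hb0, hb_mono,
    ?_, ?_⟩, ⟨a_mono, f_mono, δ_mono, τ_mono, Δ_mono, fun k hk => (a_lt_f k hk).le, f_lt, hcover,
    fun k hk n hn => hφ_eq hk hn, ?_, ?_, ?_⟩⟩
  · exact fun n _ => zpow_ne_zero _ two_ne_zero
  · simpa only [norm_zpow, RCLike.norm_ofNat] using hsum
  · exact ⟨2, fun j _ => norm_weight_le _ _ _⟩
  · exact ⟨1 / 2, by norm_num, fun j _ => le_norm_weight _ _ _⟩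
  · simp [hφ]
  · exact fun n hn => (hφ_lt hn).trans_le (minJ_level_le n)
  · intro l
    refine Set.infinite_of_forall_exists_gt fun N => ?_
    obtain ⟨k, hk⟩ := hcover (max (max N l) 1)
    have hk' := (P.mem_J.1 hk).2
    refine ⟨P.minJ (k + 1) + ((P.f (k + 1) - P.a (k + 1)) * l + 0), ?_, by omega⟩
    have hpos := Nat.sub_pos_of_lt (a_lt_f (k + 1) (by omega))
    have hmem := minJ_add_mem_J (P := P) (k := k + 1) (l := l) (by omega) (by omega) hpos
    change φ _ = l
    rw [hφ_eq (by omega) hmem, Nat.add_sub_cancel_left, add_zero, Nat.mul_div_cancel_left _ hpos]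
  · intro n hn
    rw [hb_succ, hb_succ, Nat.add_sub_cancel_left, Nat.add_sub_cancel_left,
      hlen_eq (hlevel hn) (hJ n)]
    rcases Nat.eq_zero_or_pos (φ n) with h0 | h0
    · rw [h0]
      simpa [hlen] using two_dvd _ (hlevel hn)
    · rw [hlen_eq (hlevel h0) (hJ _)]
      exact Δ_dvd _ _ (hlevel h0) (level_lt (hφ_lt hn))
  · refine ⟨1, one_pos, fun n => ?_⟩
    rw [hb_succ, prod_Ioo_add_eq_prod_range _ _ (hlen_pos n), ← norm_prod]
    rcases Nat.eq_zero_or_pos n with rfl | hn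
    · simp [hlen]
    · have hlt := Nat.mod_lt (n - P.minJ (P.level n)) (sub_pos_of_mem_J (hlevel hn) (hJ n))
      have hf := f_lt _ (hlevel hn)
      rw [Finset.prod_congr rfl fun i hi => hw_eq (n := n) (i := i + 1) (by
        have := Finset.mem_range.1 hi
        omega), prod_weight (by dsimp only [m]; omega), norm_pow, RCLike.norm_ofNat]
      exact one_le_pow₀ (by norm_num)
  · intro k hk n hn
    change b (n + 1) - b n = P.Δ k
    rw [hb_succ, Nat.add_sub_cancel_left, hlen_eq hk hn]
  · intro k hk n hn
    dsimp only
    rw [level_eq hn]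
  · intro k hk n hn i _ hi
    dsimp only
    rw [hw_eq (by rwa [hlen_eq hk hn]), hm]
    dsimp only
    rw [level_eq hn]

end Params

/-! ### The explicit parameters -/

namespace Params

theorem quadratic_le_two_pow {y : ℕ} (hy : 11 ≤ y) : 8 * y ^ 2 + 24 * y + 14 ≤ 2 ^ y := by
  induction y, hy using Nat.le_induction with
  | base => norm_num
  | succ y hy ih =>
    rw [pow_succ 2 y]
    nlinarith

theorem linear_le_two_pow {m : ℕ} (hm : 4 ≤ m) : 2 * m + 3 ≤ 2 ^ m := by
  induction m, hm using Nat.le_induction with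
  | base => norm_num
  | succ m hm ih =>
    rw [pow_succ]
    omega

section Sample

variable {δ₀ C : ℕ}

theorem sample_δ {k : ℕ} (hk : 1 ≤ k) : (sample δ₀ C).δ k = 2 ^ (C * k ^ 2 + 1) :=
  if_neg (by omega)

theorem sample_f (k : ℕ) : (sample δ₀ C).f k = 2 ^ (2 * C * k ^ 2 + 4) := by
  change 2 ^ (2 * C * k ^ 2 + 5) / 2 = _
  rw [pow_succ, Nat.mul_div_cancel _ two_pos]

theorem le_mul_sq (hC : 1 ≤ C) (k : ℕ) : k ≤ C * k ^ 2 :=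
  (Nat.le_self_pow two_ne_zero k).trans (Nat.le_mul_of_pos_left _ hC)

theorem mul_sq_le {i k : ℕ} (h : i ≤ k) : C * i ^ 2 ≤ C * k ^ 2 := by gcongr

theorem sample_a_lt_f (hC : 1 ≤ C) {k : ℕ} : (sample δ₀ C).a k < (sample δ₀ C).f k := by
  rw [sample_f]
  change k * 2 ^ (C * k ^ 2 + 1) < _
  have h1 : k < 2 ^ (C * k ^ 2) := (le_mul_sq hC k).trans_lt Nat.lt_two_pow_self
  calc k * 2 ^ (C * k ^ 2 + 1) < 2 ^ (C * k ^ 2) * 2 ^ (C * k ^ 2 + 1) :=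
        Nat.mul_lt_mul_of_pos_right h1 (by positivity)
    _ = 2 ^ (2 * C * k ^ 2 + 1) := by
        rw [← pow_add]
        ring
    _ ≤ _ := Nat.pow_le_pow_right two_pos (by omega)

theorem sample_f_lt (hC : 1 ≤ C) {k : ℕ} (hk : 1 ≤ k) :
    (sample δ₀ C).f k + 4 * (sample δ₀ C).δ k < (sample δ₀ C).Δ k := by
  rw [sample_f, sample_δ hk]
  change _ < 2 ^ (2 * C * k ^ 2 + 5)
  have h1 : 4 * 2 ^ (C * k ^ 2 + 1) = 2 ^ (C * k ^ 2 + 3) := by ring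
  have h2 := hk.trans (le_mul_sq hC k)
  have h3 : 2 ^ (C * k ^ 2 + 3) < 2 ^ (2 * C * k ^ 2 + 4) :=
    Nat.pow_lt_pow_right one_lt_two (by rw [mul_assoc]; omega)
  rw [h1, pow_succ 2 (2 * C * k ^ 2 + 4)]
  omega

theorem sample_minJ_le (k : ℕ) :
    (sample δ₀ C).minJ (k + 1) ≤ 2 ^ (k * (2 * (C * k ^ 2) + 4)) := by
  induction k with
  | zero => simp [minJ_one]
  | succ k ih =>
    set P := sample δ₀ C
    have ha : 1 ≤ P.a (k + 1) := Nat.mul_pos k.succ_pos (by positivity)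
    have hf : P.f (k + 1) = 2 ^ (2 * C * (k + 1) ^ 2 + 4) := sample_f _
    have hfpos : 1 ≤ P.f (k + 1) := hf ▸ Nat.one_le_two_pow
    have hsq : C * k ^ 2 ≤ C * (k + 1) ^ 2 := mul_sq_le k.le_succ
    calc P.minJ (k + 1 + 1) = P.minJ (k + 1) * (1 + (P.f (k + 1) - P.a (k + 1))) := by
          rw [P.minJ_succ (k + 1) (by omega)]
          ring
      _ ≤ 2 ^ (k * (2 * (C * k ^ 2) + 4)) * 2 ^ (2 * C * (k + 1) ^ 2 + 4) := by
          refine Nat.mul_le_mul ih ?_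
          rw [← hf]
          omega
      _ = 2 ^ (k * (2 * (C * k ^ 2) + 4) + (2 * (C * (k + 1) ^ 2) + 4)) := by
          rw [← pow_add, ← mul_assoc 2 C ((k + 1) ^ 2)]
      _ ≤ _ := by
          refine Nat.pow_le_pow_right two_pos ?_
          have : k * (2 * (C * k ^ 2) + 4) ≤ k * (2 * (C * (k + 1) ^ 2) + 4) := by gcongr
          rw [Nat.succ_mul k]
          exact Nat.add_le_add_right this _

theorem sample_card_J_le (k : ℕ) :
    ((sample δ₀ C).J k).card ≤ 2 ^ (k * (2 * (C * k ^ 2) + 4)) := by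
  refine le_trans ?_ (sample_minJ_le (δ₀ := δ₀) k)
  rw [J, Nat.card_Ico]
  exact Nat.sub_le _ _

theorem two_mul_sample_δ_le (hC : δ₀ + 11 ≤ C) {k : ℕ} (hk : 1 ≤ k) :
    2 * (sample δ₀ C).δ (k - 1) ≤ 2 ^ (C * k ^ 2) := by
  obtain ⟨k, rfl⟩ := Nat.exists_eq_add_of_le' hk
  rw [Nat.add_sub_cancel]
  rcases Nat.eq_zero_or_pos k with rfl | hk
  · calc 2 * (sample δ₀ C).δ 0 = 2 * δ₀ := rfl
      _ ≤ 2 * 2 ^ δ₀ := Nat.mul_le_mul_left _ Nat.lt_two_pow_self.le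
      _ = 2 ^ (δ₀ + 1) := by ring
      _ ≤ _ := Nat.pow_le_pow_right two_pos (by rw [zero_add, one_pow]; omega)
  · rw [sample_δ hk]
    calc 2 * 2 ^ (C * k ^ 2 + 1) = 2 ^ (C * k ^ 2 + 2) := by ring
      _ ≤ _ := Nat.pow_le_pow_right two_pos (by nlinarith)

/-- The estimate of the exponents behind `#J_k γ_k^{1/2} ≤ 2^{-(k+1)}`. -/
theorem sample_exponent_le (hC : δ₀ + 11 ≤ C) {k : ℕ} (hk : 1 ≤ k) :
    (sample δ₀ C).δ (k - 1) + (2 * C * k ^ 2 + 5) +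
      2 * (k * (2 * (C * k ^ 2) + 4) + (k + 1)) ≤ 2 ^ (C * k ^ 2) := by
  have h1 := two_mul_sample_δ_le hC hk
  have hy : 11 ≤ C * k ^ 2 := by nlinarith [Nat.one_le_pow 2 k hk]
  have h2 := quadratic_le_two_pow hy
  have h3 := le_mul_sq (C := C) (by omega) k
  rw [mul_assoc 2 C]
  set y := C * k ^ 2
  have h4 : k * y ≤ y ^ 2 := by
    rw [sq]
    gcongr
  have h5 : k * (2 * y + 4) = 2 * (k * y) + 4 * k := by ring
  rw [h5]
  omega

variable {p : ℝ≥0∞}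

theorem rpow_one_sub_le {x : ℝ} (hx : 1 ≤ x) : x ^ (1 - 1 / p.toReal) ≤ x := by
  refine (Real.rpow_le_rpow_of_exponent_le hx ?_).trans_eq (Real.rpow_one x)
  have : 0 ≤ 1 / p.toReal := by positivity
  linarith

theorem sample_card_mul_sqrt_γ_le (hC : δ₀ + 11 ≤ C) {k : ℕ} (hk : 1 ≤ k) :
    (((sample δ₀ C).J k).card : ℝ) * √((sample δ₀ C).γ p k) ≤ (1 / 2) ^ (k + 1) := by
  set m := k * (2 * (C * k ^ 2) + 4) with hm
  have hcard : (((sample δ₀ C).J k).card : ℝ) ≤ 2 ^ m := by exact_mod_cast sample_card_J_le k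
  have hexp := sample_exponent_le hC hk
  have hΔ : ((sample δ₀ C).Δ k : ℝ) = 2 ^ (2 * C * k ^ 2 + 5) := Nat.cast_pow _ _
  have hτ : (sample δ₀ C).τ k = 2 ^ (C * k ^ 2) := rfl
  have hγ : (sample δ₀ C).γ p k ≤ ((1 / 2) ^ (m + (k + 1))) ^ 2 := by
    calc (sample δ₀ C).γ p k ≤
          2 ^ (((sample δ₀ C).δ (k - 1) : ℤ) - 2 ^ (C * k ^ 2)) * 2 ^ (2 * C * k ^ 2 + 5) := by
          rw [γ, hΔ, hτ]
          exact mul_le_mul_of_nonneg_left (rpow_one_sub_le (one_le_pow₀ (by norm_num)))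
            (by positivity)
      _ = 2 ^ (((sample δ₀ C).δ (k - 1) : ℤ) - 2 ^ (C * k ^ 2) + (2 * C * k ^ 2 + 5 : ℕ)) := by
          rw [zpow_add₀ two_ne_zero, zpow_natCast]
      _ ≤ 2 ^ (-((2 * (m + (k + 1)) : ℕ) : ℤ)) := by
          refine zpow_le_zpow_right₀ (by norm_num) ?_
          zify at hexp
          push_cast at hexp ⊢
          linarith
      _ = ((1 / 2) ^ (m + (k + 1))) ^ 2 := by
          rw [zpow_neg, zpow_natCast, ← pow_mul, one_div, inv_pow, mul_comm 2]
  have hsqrt : √((sample δ₀ C).γ p k) ≤ (1 / 2) ^ (m + (k + 1)) :=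
    Real.sqrt_le_iff.2 ⟨by positivity, hγ⟩
  calc _ ≤ (2 : ℝ) ^ m * (1 / 2) ^ (m + (k + 1)) := by gcongr
    _ = (1 / 2) ^ (k + 1) := by
        rw [pow_add, ← mul_assoc, ← mul_pow]
        norm_num

theorem sample_γ_anti (hC : δ₀ + 11 ≤ C) :
    AntitoneOn ((sample δ₀ C).γ p) (Set.Ici 1) := by
  refine antitoneOn_nat_Ici_of_succ_le fun k hk => ?_
  set y := C * k ^ 2 with hy
  set m := C * (2 * k + 1) with hm
  have hexp : C * (k + 1) ^ 2 = y + m := by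
    rw [hy, hm]
    ring
  have hΔ : ((sample δ₀ C).Δ (k + 1) : ℝ) = (sample δ₀ C).Δ k * 2 ^ (2 * m) := by
    have h1 : (sample δ₀ C).Δ (k + 1) = 2 ^ (2 * C * (k + 1) ^ 2 + 5) := rfl
    have h2 : (sample δ₀ C).Δ k = 2 ^ (2 * C * k ^ 2 + 5) := rfl
    rw [h1, h2, mul_assoc, hexp, mul_assoc, ← hy]
    push_cast
    ring
  have hτ : (sample δ₀ C).τ (k + 1) = 2 ^ (y + m) := by rw [← hexp]; rfl
  have hτ' : (sample δ₀ C).τ k = 2 ^ y := rfl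
  have hkey : 2 ^ (y + 1) + 2 ^ y + 2 * m ≤ 2 ^ (y + m) := by
    have h1 := linear_le_two_pow (m := m) (by rw [hm]; nlinarith)
    have h2 : 1 ≤ 2 ^ y := Nat.one_le_two_pow
    rw [pow_add 2 y m, pow_succ]
    nlinarith
  rw [γ, γ, hΔ, Nat.add_sub_cancel, sample_δ hk, hτ, hτ',
    Real.mul_rpow (by positivity) (by positivity)]
  calc _ ≤ (2 : ℝ) ^ (((2 ^ (y + 1) : ℕ) : ℤ) - 2 ^ (y + m)) *
        (((sample δ₀ C).Δ k : ℝ) ^ (1 - 1 / p.toReal) * 2 ^ (2 * m)) := by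
        gcongr
        exact rpow_one_sub_le (one_le_pow₀ (by norm_num))
    _ = (2 : ℝ) ^ (((2 ^ (y + 1) : ℕ) : ℤ) - 2 ^ (y + m) + (2 * m : ℕ)) *
        ((sample δ₀ C).Δ k : ℝ) ^ (1 - 1 / p.toReal) := by
        rw [zpow_add₀ two_ne_zero, zpow_natCast]
        ring
    _ ≤ _ := by
        refine mul_le_mul_of_nonneg_right (zpow_le_zpow_right₀ (by norm_num) ?_) (by positivity)
        zify at hkey
        push_cast at hkey ⊢
        linarith [Int.natCast_nonneg ((sample δ₀ C).δ (k - 1))]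

theorem sample_cofinite (hC : 1 ≤ C) :
    (⋃ k ∈ Set.Ici 1, Set.Ico ((sample δ₀ C).a k + (sample δ₀ C).δ k)
      ((sample δ₀ C).f k + (sample δ₀ C).δ k))ᶜ.Finite := by
  set P := sample δ₀ C with hP
  have hge (k : ℕ) : k ≤ P.a k + P.δ k :=
    (Nat.le_mul_of_pos_right k (by positivity : 0 < 2 ^ (C * k ^ 2 + 1))).trans
      (Nat.le_add_right _ _)
  -- From `k = 3` on, consecutive intervals overlap.
  have hoverlap (k : ℕ) (hk : 3 ≤ k) : P.a (k + 1) + P.δ (k + 1) ≤ P.f k + P.δ k := by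
    refine le_trans ?_ (Nat.le_add_right _ _)
    rw [hP, sample_δ (by omega), sample_f]
    change (k + 1) * 2 ^ (C * (k + 1) ^ 2 + 1) + _ ≤ _
    have h1 : k + 2 ≤ 2 ^ (k + 1) := Nat.lt_two_pow_self
    calc (k + 1) * 2 ^ (C * (k + 1) ^ 2 + 1) + 2 ^ (C * (k + 1) ^ 2 + 1) =
          (k + 2) * 2 ^ (C * (k + 1) ^ 2 + 1) := by ring
      _ ≤ 2 ^ (k + 1) * 2 ^ (C * (k + 1) ^ 2 + 1) := Nat.mul_le_mul_right _ h1
      _ = 2 ^ (k + 1 + (C * (k + 1) ^ 2 + 1)) := (pow_add _ _ _).symm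
      _ ≤ 2 ^ (2 * C * k ^ 2 + 4) := by
          refine Nat.pow_le_pow_right two_pos ?_
          obtain ⟨t, rfl⟩ := Nat.exists_eq_add_of_le hk
          obtain ⟨c, rfl⟩ := Nat.exists_eq_add_of_le hC
          ring_nf
          nlinarith [Nat.zero_le (c * t), Nat.zero_le (c * t ^ 2), Nat.zero_le (t ^ 2)]
  refine (Set.finite_Iio (P.a 3 + P.δ 3)).subset fun x hx => ?_
  by_contra hx3
  rw [Set.mem_Iio, not_lt] at hx3
  have hex : ∃ t, x < P.a (t + 4) + P.δ (t + 4) :=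
    ⟨x, (Nat.lt_add_of_pos_right four_pos).trans_le (hge (x + 4))⟩
  classical
  have h1 := Nat.find_spec hex
  have h2 : P.a (Nat.find hex + 3) + P.δ (Nat.find hex + 3) ≤ x := by
    rcases Nat.eq_zero_or_pos (Nat.find hex) with h0 | h0
    · rwa [h0]
    · have := not_lt.1 (Nat.find_min hex (m := Nat.find hex - 1) (by omega))
      rwa [show Nat.find hex - 1 + 4 = Nat.find hex + 3 by omega] at this
  exact hx (Set.mem_iUnion₂.2 ⟨Nat.find hex + 3, Set.mem_Ici.2 (by omega), h2,
    h1.trans_le (hoverlap _ (by omega))⟩)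

theorem sample_conditions (hC : δ₀ + 11 ≤ C) : (sample δ₀ C).Conditions p := by
  have hC1 : 1 ≤ C := by omega
  have hgeom : HasSum (fun k : ℕ => (1 / 2 : ℝ) ^ (k + 1 + 1)) (1 / 2) := by
    have h1 := hasSum_geometric_two.mul_left (1 / 4)
    have h2 : (fun k : ℕ => 1 / 4 * (1 / 2 : ℝ) ^ k) = fun k : ℕ => (1 / 2 : ℝ) ^ (k + 1 + 1) := by
      funext k
      ring
    rwa [h2, show (1 / 4 : ℝ) * 2 = 1 / 2 by norm_num] at h1
  have hle (k : ℕ) := sample_card_mul_sqrt_γ_le (p := p) hC (Nat.le_add_left 1 k)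
  have hsum : Summable fun k : ℕ =>
      (((sample δ₀ C).J (k + 1)).card : ℝ) * √((sample δ₀ C).γ p (k + 1)) :=
    Summable.of_nonneg_of_le (fun k => by positivity) hle hgeom.summable
  refine ⟨sample_γ_anti hC, hsum, ?_, ?_, ?_, ?_, sample_cofinite hC1⟩
  · have := hsum.tsum_le_tsum hle hgeom.summable
    rw [hgeom.tsum_eq] at this
    linarith
  · filter_upwards [eventually_ge_atTop 1] with k hk
    exact Nat.mul_pos hk (by positivity)
  · refine (tendsto_one_div_atTop_nhds_zero_nat (𝕜 := ℝ)).congr' ?_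
    filter_upwards [eventually_ge_atTop 1] with k hk
    rw [sample_δ hk]
    change _ = _ / ((k * 2 ^ (C * k ^ 2 + 1) : ℕ) : ℝ)
    have hk0 : (k : ℝ) ≠ 0 := by exact_mod_cast (Nat.one_le_iff_ne_zero.1 hk)
    push_cast
    field_simp
  · refine tendsto_atTop_mono' atTop ?_ tendsto_natCast_atTop_atTop
    filter_upwards [eventually_ge_atTop 1] with k hk
    rw [sample_δ hk]
    change _ ≤ _ - (2 : ℤ) ^ (C * k ^ 2)
    have h1 : k < 2 ^ (C * k ^ 2) := (le_mul_sq hC1 k).trans_lt Nat.lt_two_pow_self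
    zify at h1
    push_cast
    rw [pow_succ]
    linarith

theorem exists_isC2Type_sample (hC : δ₀ + 11 ≤ C) : ∃ d : Data, (sample δ₀ C).IsC2Type d := by
  have hC1 : 1 ≤ C := by omega
  have hΔ (k : ℕ) : (sample δ₀ C).Δ k = 2 ^ (2 * (C * k ^ 2) + 5) := by
    rw [← mul_assoc]
    rfl
  refine exists_isC2Type ?_ ?_ ?_ ?_ ?_ (fun k _ => sample_a_lt_f hC1)
    (fun k hk => sample_f_lt hC1 hk) (fun k _ => ?_) (fun i k _ hik => ?_) ?_
  · intro i _ k _ h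
    change i * 2 ^ (C * i ^ 2 + 1) ≤ k * 2 ^ (C * k ^ 2 + 1)
    gcongr
    exact one_le_two
  · intro i _ k _ h
    rw [sample_f, sample_f]
    gcongr
    exact one_le_two
  · intro i hi k hk h
    rw [sample_δ hi, sample_δ hk]
    gcongr
    exact one_le_two
  · intro i _ k _ h
    change (2 : ℤ) ^ (C * i ^ 2) ≤ 2 ^ (C * k ^ 2)
    gcongr
    exact one_le_two
  · intro i _ k _ h
    rw [hΔ, hΔ]
    gcongr
    exact one_le_two
  · rw [hΔ]
    exact dvd_pow_self 2 (by omega)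
  · rw [hΔ, hΔ, ← pow_succ']
    refine pow_dvd_pow 2 ?_
    have : C * (i + 1) ^ 2 ≤ C * k ^ 2 := mul_sq_le hik
    nlinarith
  · have hcond := sample_conditions (p := 1) hC
    have hcover := exists_mem_J (P := sample δ₀ C) fun k _ => sample_a_lt_f hC1
    refine summable_of_sum_range_le (c := 1 / 2) (fun n => by positivity) fun N => ?_
    refine le_trans ?_ (sum_sqrt_γ_le hcond hcover ((Finset.range N).image (· + 1)) (by simp))
    rw [Finset.sum_image fun _ _ _ _ h => by simpa using h]
    refine Finset.sum_le_sum fun n _ => two_zpow_neg_τ_le_sqrt_γ ENNReal.one_ne_top ?_ ?_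
    · rw [hΔ]
      positivity
    · have := sum_sqrt_γ_le hcond hcover {n + 1} (by simp)
      rw [Finset.sum_singleton] at this
      linarith

end Sample

end Params

end CType

theorem mainTheorem3 (p : ℝ≥0∞) [Fact (1 ≤ p)] (hp : p ≠ ∞) :
    -- the general result: the operator exists, is unique, and has the stated properties
    (∀ (P : CType.Params) (d : CType.Data), P.IsC2Type d → P.Conditions p →
      (∃! T : CType.Ell p →L[ℂ] CType.Ell p, d.IsOperator p T) ∧
      ∀ T : CType.Ell p →L[ℂ] CType.Ell p, d.IsOperator p T →
        CType.IsChaotic T ∧ CType.IsTopologicallyMixing T ∧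
          ¬ CType.IsUFrequentlyHypercyclic T) ∧
    -- the explicit example, for all sufficiently large `C`
    (∀ δ₀ : ℕ, ∃ C₀ : ℕ, ∀ C : ℕ, C₀ ≤ C →
      (CType.Params.sample δ₀ C).Conditions p ∧
      (∃ d : CType.Data, (CType.Params.sample δ₀ C).IsC2Type d) ∧
      ∀ d : CType.Data, (CType.Params.sample δ₀ C).IsC2Type d →
        (∃! T : CType.Ell p →L[ℂ] CType.Ell p, d.IsOperator p T) ∧
        ∀ T : CType.Ell p →L[ℂ] CType.Ell p, d.IsOperator p T →
          CType.IsChaotic T ∧ CType.IsTopologicallyMixing T ∧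
            ¬ CType.IsUFrequentlyHypercyclic T) := by
  refine ⟨fun P d hd hcond => hd.dynamics hp hcond, fun δ₀ => ⟨δ₀ + 11, fun C hC => ?_⟩⟩
  have hcond := CType.Params.sample_conditions (p := p) hC
  exact ⟨hcond, CType.Params.exists_isC2Type_sample hC, fun d hd => hd.dynamics hp hcond⟩
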